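/- Let $a>0$, let $\Omega=(0,a)$, and let $F:(-a,a)=\Omega-\Omega\to\mathbb{C}$ be continuous and positive definite, i.e. $\sum_{i,j}\overline{c_i}c_jF(x_i-x_j)\ge 0$ for all finite systems $x_i\in\Omega$, $c_i\in\mathbb{C}$. Let $\mathscr{H}_F$ be the reproducing kernel Hilbert space of functions on $\Omega$ with kernel $(x,y)\mapsto F(x-y)$ (inner products are conjugate linear in the first variable), and put $F_y=F(\cdot-y)\in\mathscr{H}_F$ for $y\in\Omega$. For $\psi\in C_c^\infty(\Omega)$ put $F_\psi=\int_\Omega\psi(y)F_y\,dy\in\mathscr{H}_F$, so that $F_\psi(x)=\int_\Omega \psi(y)F(x-y)\,dy$. Let $D^{(F)}$ be the operator in $\mathscr{H}_F$ with domain $\{F_\psi:\psi\in C_c^\infty(\Omega)\}$ and $D^{(F)}F_\psi=F_{\psi'}$; its deficiency indices are the dimensions of $\{\xi\in\mathrm{dom}((D^{(F)})^*):(D^{(F)})^*\xi=\pm\xi\}$. Let $Ext(F)$ be the set of finite positive Borel measures $\mu$ on $\mathbb{R}$ with $\widehat{\mu}(x):=\int_{\mathbb{R}}e^{i\lambda x}\,d\mu(\lambda)=F(x)$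 for all $x\in(-a,a)$. Let $Ext_1(F)$ (Type I) be the set of those $\mu\in Ext(F)$ that are realized in $\mathscr{H}_F$ itself: there is a strongly continuous unitary one-parameter group $\{U(t)\}_{t\in\mathbb{R}}$ on $\mathscr{H}_F$, whose infinitesimal generator extends $D^{(F)}$, such that $\widehat{\mu}(t)=\langle F_0,U(t)F_0\rangle_{\mathscr{H}_F}$ for all $t\in\mathbb{R}$, where $F_0\in\mathscr{H}_F$ is the function $x\mapsto F(x)$ on $\Omega$. Let $Ext_2(F)=Ext(F)\setminus Ext_1(F)$ (Type II). Theorem. If $F$ is (real-)analytic in a neighborhood of $0$, then $D^{(F)}$ is essentially skew-adjoint, i.e. it is densely defined and closable and its closure $A$ satisfies $A=-A^*$, and it has deficiency indices $(0,0)$. Moreover there is a measure $\mu$ with $Ext(F)=Ext_1(F)=\{\mu\}$; in particular $Ext(F)$ is a singleton, its only element is of Type I, and $Ext_2(F)=\emptyset$. -/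

import Mathlib

open MeasureTheory Set Topology
open scoped ComplexOrder ContDiff InnerProductSpace LinearPMap ComplexConjugate

noncomputable section

/-! ### Skew-symmetric operators in a complex Hilbert space -/

section Operators

variable {H : Type*} [NormedAddCommGroup H] [InnerProductSpace ℂ H] [CompleteSpace H]

/-- The eigenspace `{ξ ∈ dom T* | T* ξ = c ξ}` of the adjoint of `T`. -/
def adjointEigenspace (T : H →ₗ.[ℂ] H) (c : ℂ) : Submodule ℂ H :=
  (LinearMap.ker (T†.toFun - c • T†.domain.subtype)).map T†.domain.subtype

/-- The deficiency indices `(dim DEF⁺, dim DEF⁻)` of a skew-symmetric operator `T`, where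
`DEF^± = {ξ ∈ dom T* | T* ξ = ± ξ}`. -/
def deficiencyIndices (T : H →ₗ.[ℂ] H) : Cardinal × Cardinal :=
  (Module.rank ℂ (adjointEigenspace T 1), Module.rank ℂ (adjointEigenspace T (-1)))

/-- `T` is essentially skew-adjoint: it is densely defined and closable, and its closure `A`
satisfies `A = -A*` (recall that `A* = T*`). -/
def IsEssentiallySkewAdjoint (T : H →ₗ.[ℂ] H) : Prop :=
  Dense (T.domain : Set H) ∧ T.IsClosable ∧ T.closure = -T.closure†

/-- A strongly continuous unitary one-parameter group on `K`. -/
structure UnitaryGroup (K : Type*) [NormedAddCommGroup K] [InnerProductSpace ℂ K] where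
  U : ℝ → K ≃ₗᵢ[ℂ] K
  map_zero : ∀ ξ, U 0 ξ = ξ
  map_add : ∀ s t ξ, U (s + t) ξ = U s (U t ξ)
  continuous : ∀ ξ, Continuous fun t => U t ξ

/-- The infinitesimal generator of the group `U` extends the operator `T`: every `ξ ∈ dom T` lies
in the domain of the generator, and the generator maps it to `T ξ`. -/
def UnitaryGroup.GeneratorExtends (V : UnitaryGroup H) (T : H →ₗ.[ℂ] H) : Prop :=
  ∀ ξ : T.domain, HasDerivAt (fun t : ℝ => V.U t (ξ : H)) (T ξ) 0

end Operators

/-! ### Test functions -/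

/-- The space `C_c^∞(0, a)` of complex test functions. -/
def testFn (a : ℝ) : Submodule ℂ (ℝ → ℂ) where
  carrier := {ψ | ContDiff ℝ ∞ ψ ∧ HasCompactSupport ψ ∧ tsupport ψ ⊆ Ioo 0 a}
  zero_mem' := ⟨contDiff_const, HasCompactSupport.zero, by simp [tsupport]⟩
  add_mem' := fun {f g} hf hg => ⟨hf.1.add hg.1, hf.2.1.add hg.2.1,
    (tsupport_add f g).trans (union_subset hf.2.2 hg.2.2)⟩
  smul_mem' := fun c f hf => ⟨contDiff_const.smul hf.1,
    hf.2.1.smul_left (f := fun _ => c),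
    (closure_mono (Function.support_const_smul_subset c f)).trans hf.2.2⟩

/-- Differentiation `ψ ↦ ψ'` on `C_c^∞(0, a)`. -/
def testFn.deriv (a : ℝ) : testFn a →ₗ[ℂ] testFn a where
  toFun ψ := ⟨_root_.deriv ψ.1,
    (contDiff_infty_iff_deriv.1 ψ.2.1).2, ψ.2.2.1.deriv,
    (tsupport_deriv_subset (f := ψ.1)).trans ψ.2.2.2⟩
  map_add' f g := by
    ext x
    exact deriv_add ((f.2.1.differentiable (by simp)) x) ((g.2.1.differentiable (by simp)) x)
  map_smul' c f := by
    ext x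
    exact deriv_const_smul c ((f.2.1.differentiable (by simp)) x)

/-! ### Locally defined continuous positive definite functions and their Hilbert spaces -/

/-- Continuous positive definite functions on `(-a, a) = Ω - Ω`, `Ω = (0, a)`.
Only the values of `toFun` on `(-a, a)` matter. -/
structure LocalPD (a : ℝ) where
  toFun : ℝ → ℂ
  continuousOn : ContinuousOn toFun (Ioo (-a) a)
  posDef : ∀ (n : ℕ) (x : Fin n → ℝ) (c : Fin n → ℂ), (∀ i, x i ∈ Ioo 0 a) →
    0 ≤ ∑ i, ∑ j, conj (c i) * c j * toFun (x i - x j)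

namespace LocalPD

variable {a : ℝ} (F : LocalPD a)

/-- The kernel `(x, y) ↦ F (x - y)` on `Ω × Ω`, a number being identified with the corresponding
multiplication operator on `ℂ`. -/
def kernel : Matrix (Ioo (0 : ℝ) a) (Ioo (0 : ℝ) a) (ℂ →L[ℂ] ℂ) :=
  .of fun x y => F.toFun (x - y) • ContinuousLinearMap.id ℂ ℂ

theorem conj_symm (x y : Ioo (0 : ℝ) a) :
    conj (F.toFun (x - y)) = F.toFun (y - x) := by
  have h0 := F.posDef 1 ![x.1] ![1] (by simp)
  have h1 := F.posDef 2 ![x.1, y.1] ![1, 1] (by simpa [Fin.forall_fin_two] using ⟨x.2, y.2⟩)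
  have h2 := F.posDef 2 ![x.1, y.1] ![1, Complex.I]
    (by simpa [Fin.forall_fin_two] using ⟨x.2, y.2⟩)
  simp [Fin.sum_univ_two, Complex.le_def] at h0 h1 h2
  apply Complex.ext <;> simp <;> linarith [h0.2, h1.2, h2.2]

instance kernel_posSemidef : Fact F.kernel.PosSemidef := by
  have key := (RKHS.posSemidef_tfae (K := F.kernel)).out 0 2
  refine ⟨key.2 (And.intro ?_ fun v => ?_)⟩
  · ext x y
    simp only [kernel, Matrix.conjTranspose_apply, Matrix.of_apply,
      ContinuousLinearMap.star_eq_adjoint, map_smulₛₗ, ContinuousLinearMap.adjoint_id,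
      F.conj_symm]
  · let e := v.support.equivFin.symm
    have h := F.posDef v.support.card (fun i => ((e i).1 : ℝ)) (fun i => v (e i).1)
      (fun i => (e i).1.2)
    have h2 : ∀ g : Ioo (0 : ℝ) a → ℂ, ∑ i, g (e i).1 = ∑ x ∈ v.support, g x := fun g => by
      rw [e.sum_comp (fun s => g s.1), Finset.sum_coe_sort]
    have h3 : (v.sum fun x w => v.sum fun x' w' => ⟪F.kernel x' x w, w'⟫_ℂ) =
        ∑ i, ∑ j, conj (v (e i).1) * v (e j).1 * F.toFun ((e i).1 - (e j).1) := by
      rw [h2 fun x => ∑ j, conj (v x) * v (e j).1 * F.toFun (x - (e j).1)]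
      refine Finset.sum_congr rfl fun x _ => ?_
      rw [h2 fun y => conj (v x) * v y * F.toFun (x - y)]
      refine Finset.sum_congr rfl fun y _ => ?_
      simp only [kernel, Matrix.of_apply, smul_apply,
        ContinuousLinearMap.id_apply, smul_eq_mul, RCLike.inner_apply, map_mul, F.conj_symm]
      ring
    rw [h3]
    exact (Complex.le_def.1 h).1

/-- The reproducing kernel Hilbert space `H_F` of functions on `Ω = (0, a)`, with inner product
conjugate linear in the first variable. -/
abbrev HF : Type := RKHS.OfKernel F.kernel

/-- The kernel function `F_y = F (· - y) ∈ H_F`, for `y ∈ Ω`. -/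
def kerFn (y : Ioo (0 : ℝ) a) : F.HF := RKHS.kerFun F.HF y 1

theorem kerFn_apply (x y : Ioo (0 : ℝ) a) : F.kerFn y x = F.toFun (x - y) := by
  rw [kerFn, RKHS.kerFun_apply, RKHS.OfKernel.kernel_ofKernel]
  simp [kernel]

theorem inner_kerFn (y : Ioo (0 : ℝ) a) (ξ : F.HF) : ⟪F.kerFn y, ξ⟫_ℂ = ξ y := by
  simp [kerFn]

theorem norm_kerFn (y : Ioo (0 : ℝ) a) : ‖F.kerFn y‖ = √(F.toFun 0).re := by
  rw [@norm_eq_sqrt_re_inner ℂ, inner_kerFn, kerFn_apply]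
  simp

theorem continuous_kerFn : Continuous F.kerFn := by
  have hn : ∀ x y, ‖F.kerFn y - F.kerFn x‖ ^ 2 =
      2 * (F.toFun 0).re - 2 * (F.toFun (x - y)).re := fun x y => by
    rw [@norm_sub_sq ℂ, ← @inner_self_eq_norm_sq ℂ, ← @inner_self_eq_norm_sq ℂ]
    simp only [inner_kerFn, kerFn_apply, sub_self, ← F.conj_symm x y]
    simp
    ring
  refine continuous_iff_continuousAt.2 fun x => ?_
  have h0 : (0 : ℝ) ∈ Ioo (-a) a := by
    have := x.2.1.trans x.2.2
    constructor <;> linarith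
  have hF : ContinuousAt F.toFun 0 := F.continuousOn.continuousAt (isOpen_Ioo.mem_nhds h0)
  have h1 : Filter.Tendsto (fun y : Ioo (0 : ℝ) a => (x : ℝ) - y) (𝓝 x) (𝓝 0) := by
    have : Continuous fun y : Ioo (0 : ℝ) a => (x : ℝ) - y := by fun_prop
    simpa using this.tendsto x
  have h2 := (Complex.continuous_re.tendsto _).comp (hF.tendsto.comp h1)
  have h3 : Filter.Tendsto (fun y => ‖F.kerFn y - F.kerFn x‖ ^ 2) (𝓝 x) (𝓝 0) := by
    simp only [hn]
    simpa using (h2.const_mul 2).const_sub (2 * (F.toFun 0).re)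
  rw [ContinuousAt, tendsto_iff_norm_sub_tendsto_zero]
  simpa using h3.sqrt

theorem integrable_kerFn (ψ : testFn a) :
    Integrable (fun y : Ioo (0 : ℝ) a => ψ.1 y • F.kerFn y)
      (volume.comap Subtype.val) := by
  obtain ⟨C, hC⟩ := ψ.2.2.1.exists_bound_of_continuous ψ.2.1.continuous
  have hfin : IsFiniteMeasure ((volume : Measure ℝ).comap (Subtype.val : Ioo (0 : ℝ) a → ℝ)) := by
    refine ⟨?_⟩
    rw [comap_subtype_coe_apply measurableSet_Ioo, image_univ, Subtype.range_coe]
    exact measure_Ioo_lt_top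
  have hcont : Continuous fun y : Ioo (0 : ℝ) a => ψ.1 y • F.kerFn y :=
    (ψ.2.1.continuous.comp continuous_subtype_val).smul F.continuous_kerFn
  refine Integrable.of_bound hcont.aestronglyMeasurable (C * √(F.toFun 0).re)
    (Filter.Eventually.of_forall fun y => ?_)
  rw [norm_smul, norm_kerFn]
  gcongr
  exact hC y

/-- The vector `F_ψ = ∫_Ω ψ(y) F_y dy` of `H_F`, for `ψ ∈ C_c^∞(Ω)`. -/
def smear : testFn a →ₗ[ℂ] F.HF where
  toFun ψ := ∫ y : Ioo (0 : ℝ) a, ψ.1 y • F.kerFn y ∂(volume.comap Subtype.val)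
  map_add' f g := by
    rw [← integral_add (F.integrable_kerFn f) (F.integrable_kerFn g)]
    simp [add_smul]
  map_smul' c f := by
    simp [← integral_smul, mul_smul]

theorem smear_apply (ψ : testFn a) (x : Ioo (0 : ℝ) a) :
    F.smear ψ x = ∫ y in Ioo (0 : ℝ) a, ψ.1 y * F.toFun (x - y) := by
  have h := integral_inner (𝕜 := ℂ) (F.integrable_kerFn ψ) (F.kerFn x)
  rw [← inner_kerFn]
  refine h.symm.trans ?_
  simp only [inner_smul_right, inner_kerFn, kerFn_apply]
  exact integral_subtype_comap measurableSet_Ioo fun y => ψ.1 y * F.toFun (x - y)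

theorem smear_deriv_eq_zero (ψ : testFn a) (h : F.smear ψ = 0) :
    F.smear (testFn.deriv a ψ) = 0 := by
  let g : ℝ → ℂ := (Ioo (-a) a).indicator F.toFun
  have hb : ∀ t ∈ Ioo (-a) a, ‖F.toFun t‖ ≤ (F.toFun 0).re := fun t ht => by
    have hx : (a + t) / 2 ∈ Ioo 0 a := by
      have := ht.1; have := ht.2
      constructor <;> linarith
    have hy : (a - t) / 2 ∈ Ioo 0 a := by
      have := ht.1; have := ht.2
      constructor <;> linarith
    have h1 := norm_inner_le_norm (𝕜 := ℂ) (F.kerFn ⟨_, hx⟩) (F.kerFn ⟨_, hy⟩)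
    have h2 : 0 ≤ (F.toFun 0).re := by
      have := F.posDef 1 (fun _ => (a + t) / 2) (fun _ => 1) fun _ => hx
      simpa using (Complex.le_def.1 this).1
    rw [norm_kerFn, norm_kerFn, Real.mul_self_sqrt h2, inner_kerFn, kerFn_apply] at h1
    have h3 : (a + t) / 2 - (a - t) / 2 = t := by ring
    simpa only [h3] using h1
  have hg : LocallyIntegrable g := by
    refine Integrable.locallyIntegrable ?_
    rw [integrable_indicator_iff measurableSet_Ioo]
    exact IntegrableOn.of_bound measure_Ioo_lt_top
      (F.continuousOn.aestronglyMeasurable measurableSet_Ioo) _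
      ((ae_restrict_iff' measurableSet_Ioo).2 (Filter.Eventually.of_forall hb))
  have hconv : ∀ (φ : testFn a) (x : Ioo (0 : ℝ) a),
      F.smear φ x = convolution φ.1 g (ContinuousLinearMap.mul ℝ ℂ) volume x := fun φ x => by
    rw [smear_apply, convolution, ← integral_indicator measurableSet_Ioo]
    refine integral_congr_ae (Filter.Eventually.of_forall fun y => ?_)
    by_cases hy : y ∈ Ioo 0 a
    · have : (x : ℝ) - y ∈ Ioo (-a) a := by
        have := x.2.1; have := x.2.2; have := hy.1; have := hy.2
        constructor <;> linarith
      simp [g, hy, this]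
    · have : φ.1 y = 0 := image_eq_zero_of_notMem_tsupport fun h => hy (φ.2.2.2 h)
      simp [hy, this]
  ext x
  have hd := ψ.2.2.1.hasDerivAt_convolution_left (ContinuousLinearMap.mul ℝ ℂ)
    (ψ.2.1.of_le (by simp)) hg (x : ℝ)
  have hz : convolution ψ.1 g (ContinuousLinearMap.mul ℝ ℂ) volume =ᶠ[𝓝 (x : ℝ)]
      fun _ => (0 : ℂ) := by
    filter_upwards [isOpen_Ioo.mem_nhds x.2] with t ht
    rw [← hconv ψ ⟨t, ht⟩, h]
    simp
  rw [hconv]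
  have h0 := hd.unique ((hasDerivAt_const (x : ℝ) (0 : ℂ)).congr_of_eventuallyEq hz)
  rw [RKHS.coe_zero]
  exact h0

/-- The graph `{(F_ψ, F_ψ') | ψ ∈ C_c^∞(Ω)}`. -/
def graphD : Submodule ℂ (F.HF × F.HF) :=
  LinearMap.range (F.smear.prod (F.smear ∘ₗ testFn.deriv a))

theorem graphD_functional : ∀ p ∈ F.graphD, p.1 = 0 → p.2 = 0 := by
  rintro _ ⟨ψ, rfl⟩ h
  exact F.smear_deriv_eq_zero ψ h

/-- The operator `D^(F)` in `H_F` with domain `{F_ψ | ψ ∈ C_c^∞(Ω)}` and `D^(F) F_ψ = F_ψ'`. -/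
def D : F.HF →ₗ.[ℂ] F.HF := F.graphD.toLinearPMap

theorem graph_D : F.D.graph = F.graphD :=
  Submodule.toLinearPMap_graph_eq _ fun p hp => F.graphD_functional p hp

/-- `Ext(F)`: the finite positive Borel measures `μ` on `ℝ` whose transform
`x ↦ ∫ e^{iλx} dμ(λ)` extends `F`. -/
def Ext : Set (Measure ℝ) :=
  {μ | IsFiniteMeasure μ ∧ ∀ x ∈ Ioo (-a) a, charFun μ x = F.toFun x}

/-- `Ext₁(F)`: the extensions of Type I, i.e. those which are realized in `H_F` itself, as
`t ↦ ⟨F_0, U(t) F_0⟩` for a unitary one-parameter group `U` on `H_F` whose (skew-adjoint)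
generator extends `D^(F)`; here `F_0` is the element `x ↦ F(x)` of `H_F`. -/
def Ext₁ : Set (Measure ℝ) :=
  {μ | μ ∈ F.Ext ∧ ∃ (V : UnitaryGroup F.HF) (F₀ : F.HF),
    (∀ x : Ioo (0 : ℝ) a, F₀ x = F.toFun x) ∧ V.GeneratorExtends F.D ∧
    ∀ t : ℝ, charFun μ t = ⟪F₀, V.U t F₀⟫_ℂ}

/-- `Ext₂(F)`: the extensions of Type II. -/
def Ext₂ : Set (Measure ℝ) := F.Ext \ F.Ext₁

end LocalPD

end

/-! The engine is a uniqueness principle (`inner_eq_zero_of_analyticAt`): if F is analytic at 0, a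
vector orthogonal to F_y for all y in some nonempty open subset of Ω is orthogonal to every F_y,
hence zero. Only the germ of F at 0 is needed, because squared norms of N-th differences of y ↦ F_y
are 2N-th differences of F at 0; Cauchy's estimates bound them by about (N!)², which makes y ↦ ⟨ξ,
F_y⟩ analytic with a radius independent of the point.

Hence the F_y with y in any small window are already total. Translation F_y ↦ F_{y-t} preserves the
Gram kernel, so it extends from the middle third of Ω to a unitary operator of the whole space when
|t| < a/3. These operators form a local group, which extends to a strongly continuous unitary group
U on H_F (`exists_unitaryGroup`). Its generator extends D^(F). Smeared vectors with support in the
middle third form a total set whose orbits stay in the domain for a short time; this forces the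
generator to extend minus the adjoint of D^(F), so that adjoint is skew-symmetric. Essential
skew-adjointness and zero deficiency indices follow.

Existence of an extension is Bochner's theorem for t ↦ ⟨F_0, U(t)F_0⟩, proved here with Fejér
measures and Lévy continuity; it is of Type I by construction. For uniqueness (`charFun_eq`), any
extension μ embeds H_F in L²(μ) through exponentials. The uniqueness principle forces U(t) to become
translation of the frequency index, so the transform of μ is this same coefficient. -/

/-! ### Analytic kernels: uniqueness of continuation -/

/-- A function that is real-analytic at `0` has iterated derivatives near `0` that satisfy Cauchy's
estimates. -/
theorem AnalyticAt.exists_derivatives_bound {g : ℝ → ℂ} (hg : AnalyticAt ℝ g 0) :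
    ∃ r > 0, ∃ R > 0, ∃ M ≥ 0, ∃ f : ℕ → ℝ → ℂ, f 0 = g ∧
      (∀ n x, |x| < r → HasDerivAt (f n) (f (n + 1) x) x) ∧
      ∀ n x, |x| < r → ‖f n x‖ ≤ M * n.factorial / R ^ n := by
  obtain ⟨p, ρ, hp⟩ := hg
  obtain ⟨s, hs0, hsρ⟩ := ENNReal.lt_iff_exists_nnreal_btwn.1 hp.r_pos
  have hs : (0 : ℝ) < s := by exact_mod_cast hs0
  obtain ⟨C, hC0, hC⟩ := p.norm_mul_pow_le_of_lt_radius (hsρ.trans_le hp.r_le)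
  set G : ℂ → ℂ := fun z => ∑' n, z ^ n * p.coeff n with hG
  -- Half of the radius s gives a geometric majorant, so the series sums to a bounded holomorphic
  -- function on a complex disc.
  have hterm : ∀ n (z : ℂ), ‖z‖ < s / 2 → ‖z ^ n * p.coeff n‖ ≤ C * (1 / 2) ^ n := by
    intro n z hz
    rw [norm_mul, norm_pow, ← p.norm_apply_eq_norm_coef]
    calc ‖z‖ ^ n * ‖p n‖ ≤ (s / 2) ^ n * ‖p n‖ := by gcongr
      _ = (‖p n‖ * s ^ n) * (1 / 2) ^ n := by rw [div_pow, div_pow]; ring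
      _ ≤ C * (1 / 2) ^ n := by gcongr; exact hC n
  have hsum : Summable fun n : ℕ => C * (1 / 2 : ℝ) ^ n := summable_geometric_two.mul_left C
  have hdiff : DifferentiableOn ℂ G (Metric.ball 0 (s / 2)) := by
    refine Complex.differentiableOn_tsum_of_summable_norm hsum (fun n => ?_) Metric.isOpen_ball
      fun n z hz => hterm n z (by simpa using hz)
    fun_prop
  have hbound : ∀ z ∈ Metric.ball (0 : ℂ) (s / 2), ‖G z‖ ≤ C * 2 := fun z hz =>
    tsum_of_norm_bounded (hasSum_geometric_two.mul_left C) fun n => hterm n z (by simpa using hz)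
  have hgG : ∀ x : ℝ, |x| < s / 2 → g x = G x := fun x hx => by
    have hx' : x ∈ Metric.eball (0 : ℝ) ρ := by
      rw [Metric.mem_eball, edist_zero_right]
      refine lt_trans ?_ hsρ
      rw [enorm_eq_nnnorm, ENNReal.coe_lt_coe, ← NNReal.coe_lt_coe, coe_nnnorm, Real.norm_eq_abs]
      linarith
    have h := (hp.hasSum hx').tsum_eq
    rw [zero_add] at h
    rw [← h, hG]
    refine tsum_congr fun n => ?_
    rw [p.apply_eq_pow_smul_coeff, Complex.real_smul, Complex.ofReal_pow]
  have hball : ∀ x : ℝ, |x| < s / 4 → (x : ℂ) ∈ Metric.ball (0 : ℂ) (s / 2) := fun x hx => by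
    simp only [mem_ball_zero_iff, Complex.norm_real, Real.norm_eq_abs]
    linarith
  have han : ∀ n, AnalyticOnNhd ℂ (iteratedDeriv n G) (Metric.ball 0 (s / 2)) := fun n => by
    rw [iteratedDeriv_eq_iterate]
    exact (hdiff.analyticOnNhd Metric.isOpen_ball).iterated_deriv n
  have hder : ∀ n x, |x| < (s : ℝ) / 4 →
      HasDerivAt (fun y : ℝ => iteratedDeriv n G y) (iteratedDeriv (n + 1) G x) x := by
    intro n x hx
    have h := (han n _ (hball x hx)).differentiableAt.hasDerivAt
    rw [← iteratedDeriv_succ] at h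
    exact h.comp_ofReal
  -- Circles of radius s/8 about points with |x| < s/4 stay inside the disc of radius s/2. Index 0
  -- is `g` itself, which is known to agree with G only near 0.
  refine ⟨s / 4, by positivity, s / 8, by positivity, C * 2, by positivity,
    fun n x => if n = 0 then g x else iteratedDeriv n G x, by simp, fun n x hx => ?_,
    fun n x hx => ?_⟩
  · refine (hder n x hx).congr_of_eventuallyEq ?_
    have : ∀ᶠ y : ℝ in 𝓝 x, |y| < s / 4 := continuous_abs.continuousAt.eventually_lt_const hx
    filter_upwards [this] with y hy
    split_ifs with h
    · rw [h, iteratedDeriv_zero, hgG y (by linarith)]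
    · rfl
  · have hcl : Metric.closedBall (x : ℂ) (s / 8) ⊆ Metric.ball (0 : ℂ) (s / 2) :=
      Metric.closedBall_subset_ball' (by
        simp only [dist_zero_right, Complex.norm_real, Real.norm_eq_abs]
        linarith)
    have h := Complex.norm_iteratedDeriv_le_of_forall_mem_sphere_norm_le n
      (by positivity : (0 : ℝ) < s / 8) ((hdiff.mono hcl).diffContOnCl_ball subset_rfl) fun z hz =>
        hbound z (hcl (Metric.sphere_subset_closedBall hz))
    have he : (if n = 0 then g x else iteratedDeriv n G x) = iteratedDeriv n G x := by
      split_ifs with h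
      · rw [h, iteratedDeriv_zero, hgG x (by linarith)]
      · rfl
    change ‖(if n = 0 then g x else iteratedDeriv n G x)‖ ≤ _
    rw [he]
    exact h.trans_eq (by ring)

/-! ### Finite differences of functions and of Gram kernels -/

/-- The negative of the symmetric second difference with step `h`. -/
def negSecondDiff (h : ℝ) (g : ℝ → ℂ) (u : ℝ) : ℂ := 2 * g u - g (u + h) - g (u - h)

/-- The derivative of s ↦ f(u+s) + f(u-s) is f'(u+s) - f'(u-s), of norm at most 2|h|B; the mean
value inequality is used once for f' and once for this sum. The factor 2 is not sharp, but harmless.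
-/
theorem norm_negSecondDiff_le {f f' f'' : ℝ → ℂ} {r B u h : ℝ}
    (hf : ∀ x, |x| < r → HasDerivAt f (f' x) x) (hf' : ∀ x, |x| < r → HasDerivAt f' (f'' x) x)
    (hB : ∀ x, |x| < r → ‖f'' x‖ ≤ B) (hu : |u| + |h| < r) :
    ‖negSecondDiff h f u‖ ≤ 2 * h ^ 2 * B := by
  have hin : ∀ s ∈ uIcc 0 h, |u + s| < r ∧ |u - s| < r ∧ |s| ≤ |h| := fun s hs => by
    have h1 : |s| ≤ |h| := by simpa using abs_sub_left_of_mem_uIcc hs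
    exact ⟨by linarith [abs_add_le u s], by linarith [abs_sub u s], h1⟩
  have hball : ∀ x, x ∈ Metric.ball (0 : ℝ) r ↔ |x| < r := fun x => by simp
  have h1 : ∀ s ∈ uIcc 0 h, ‖f' (u + s) - f' (u - s)‖ ≤ 2 * |h| * B := fun s hs => by
    obtain ⟨ha, hb, hc⟩ := hin s hs
    have hB0 : 0 ≤ B := (norm_nonneg _).trans (hB _ ha)
    have := (convex_ball (0 : ℝ) r).norm_image_sub_le_of_norm_hasDerivWithin_le
      (fun x hx => (hf' x ((hball x).1 hx)).hasDerivWithinAt) (fun x hx => hB x ((hball x).1 hx))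
      ((hball _).2 hb) ((hball _).2 ha)
    refine this.trans ?_
    rw [show u + s - (u - s) = 2 * s by ring, Real.norm_eq_abs, abs_mul, abs_two, mul_comm]
    gcongr
  have h2 : ∀ s ∈ uIcc 0 h, HasDerivWithinAt (fun s => f (u + s) + f (u - s))
      (f' (u + s) - f' (u - s)) (uIcc 0 h) s := fun s hs => by
    obtain ⟨ha, hb, -⟩ := hin s hs
    have hp := (hf _ ha).comp_const_add u s
    have hm := (hf _ hb).comp_const_sub u s
    exact ((hp.add hm).congr_deriv (sub_eq_add_neg _ _).symm).hasDerivWithinAt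
  have := (convex_uIcc (0 : ℝ) h).norm_image_sub_le_of_norm_hasDerivWithin_le h2 h1
    left_mem_uIcc right_mem_uIcc
  rw [negSecondDiff, ← norm_neg]
  simp only [add_zero, sub_zero, Real.norm_eq_abs] at this
  calc _ = ‖f (u + h) + f (u - h) - (f u + f u)‖ := by congr 1; ring
    _ ≤ 2 * |h| * B * |h| := this
    _ = 2 * h ^ 2 * B := by rw [← sq_abs h]; ring

/-- Second differences of a chain of derivatives form such a chain again, on an interval shortened
by |h|. Each step of the induction trades two derivatives for a factor 2h². -/
theorem norm_iterate_negSecondDiff_le {h : ℝ} (N : ℕ) : ∀ {f : ℕ → ℝ → ℂ} {r B u : ℝ},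
    (∀ n x, |x| < r → HasDerivAt (f n) (f (n + 1) x) x) →
    (∀ x, |x| < r → ‖f (2 * N) x‖ ≤ B) → |u| + N * |h| < r →
    ‖(negSecondDiff h)^[N] (f 0) u‖ ≤ (2 * h ^ 2) ^ N * B := by
  induction N with
  | zero => intro f r B u _ hB hu; simpa using hB u (by simpa using hu)
  | succ N ih =>
    intro f r B u hf hB hu
    push_cast at hu
    have hin : ∀ x, |x| < r - |h| → |x + h| < r ∧ |x - h| < r ∧ |x| < r := fun x hx =>
      ⟨by linarith [abs_add_le x h], by linarith [abs_sub x h], by linarith [abs_nonneg h]⟩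
    rw [Function.iterate_succ_apply]
    have := ih (f := fun n => negSecondDiff h (f n)) (r := r - |h|) (B := 2 * h ^ 2 * B) (u := u)
      (fun n x hx => by
        obtain ⟨h1, h2, h3⟩ := hin x hx
        exact (((hf n x h3).const_mul 2).sub ((hf n _ h1).comp_add_const x h)).sub
          ((hf n _ h2).comp_sub_const x h))
      (fun x hx => norm_negSecondDiff_le (hf _) (hf _) (fun x hx => hB x hx) (by linarith))
      (by linarith)
    calc _ ≤ _ := this
      _ = _ := by ring

section

variable {H : Type*} [NormedAddCommGroup H] [InnerProductSpace ℂ H]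

/-- For a Gram kernel depending only on i - j, a forward difference in both arguments is one
negative second difference of the kernel. `K` marks how far the progression stays where the kernel
is known. -/
theorem inner_iterate_fwdDiff {v : ℕ → H} {g : ℝ → ℂ} {h : ℝ} {K : ℕ}
    (hv : ∀ i j, i ≤ K → j ≤ K → ⟪v i, v j⟫_ℂ = g ((i - j) * h)) (n : ℕ) :
    ∀ i j, n + i ≤ K → n + j ≤ K →
      ⟪(fwdDiff 1)^[n] v i, (fwdDiff 1)^[n] v j⟫_ℂ = (negSecondDiff h)^[n] g ((i - j) * h) := by
  induction n with
  | zero => intro i j hi hj; exact hv i j (by omega) (by omega)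
  | succ n ih =>
    intro i j hi hj
    simp only [Function.iterate_succ_apply', fwdDiff, inner_sub_left, inner_sub_right]
    rw [ih _ _ (by omega) (by omega), ih _ _ (by omega) (by omega), ih _ _ (by omega) (by omega),
      ih _ _ (by omega) (by omega), negSecondDiff]
    push_cast
    rw [show ((i : ℝ) + 1 - (j + 1)) * h = (i - j) * h by ring,
      show ((i : ℝ) + 1 - j) * h = (i - j) * h + h by ring,
      show ((i : ℝ) - (j + 1)) * h = (i - j) * h - h by ring]
    ring

/-- A discrete Taylor estimate: with N zero initial values only the N-th differences contribute, and
Pascal's rule sums their bounds. -/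
theorem norm_le_choose_mul_of_fwdDiff (N : ℕ) : ∀ {f : ℕ → ℂ} {K : ℕ} {B : ℝ},
    (∀ k < N, f k = 0) → (∀ k, k + N ≤ K → ‖(fwdDiff 1)^[N] f k‖ ≤ B) →
    ∀ k ≤ K, ‖f k‖ ≤ k.choose N * B := by
  induction N with
  | zero => intro f K B _ hB k hk; simpa using hB k hk
  | succ N ih =>
    intro f K B h0 hB k
    have h1 : ∀ k, k + 1 ≤ K → ‖fwdDiff 1 f k‖ ≤ k.choose N * B := fun k hk =>
      ih (K := K - 1) (fun k hk => by simp [fwdDiff, h0 k (by omega), h0 (k + 1) (by omega)])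
        (fun k hk => hB k (by omega)) k (by omega)
    induction k with
    | zero => intro _; simp [h0 0 (by omega)]
    | succ k ihk =>
      intro hk
      have h2 : f (k + 1) = fwdDiff 1 f k + f k := by simp [fwdDiff]
      rw [h2, Nat.choose_succ_succ]
      push_cast
      calc _ ≤ _ := norm_add_le _ _
        _ ≤ _ := by linarith [h1 k hk, ihk (by omega)]

theorem inner_iterate_fwdDiff_right (ξ : H) (v : ℕ → H) (n k : ℕ) :
    (fwdDiff 1)^[n] (fun k => ⟪ξ, v k⟫_ℂ) k = ⟪ξ, (fwdDiff 1)^[n] v k⟫_ℂ := by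
  induction n generalizing k with
  | zero => rfl
  | succ n ih => simp only [Function.iterate_succ_apply', fwdDiff, ih, inner_sub_right]

theorem factorial_two_mul_le (N : ℕ) : (2 * N).factorial ≤ 4 ^ N * N.factorial ^ 2 := by
  have h := Nat.choose_mul_factorial_mul_factorial (n := 2 * N) (k := N) (by omega)
  rw [show 2 * N - N = N by omega] at h
  rw [← h, mul_assoc, ← sq]
  gcongr
  calc (2 * N).choose N ≤ ∑ m ∈ Finset.range (2 * N + 1), (2 * N).choose m :=
        Finset.single_le_sum (f := fun m => (2 * N).choose m) (fun _ _ => Nat.zero_le _)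
          (by simp; omega)
    _ = 4 ^ N := by rw [Nat.sum_range_choose, pow_mul]; norm_num

/-- Vectors with translation invariant Gram kernel that is analytic at `0`: a vector orthogonal to
them near one point is orthogonal to them within a fixed distance of that point. -/
theorem exists_radius_inner_eq_zero {a : ℝ} {E : ℝ → H} {F : ℝ → ℂ} (hF : AnalyticAt ℝ F 0)
    (hE : ∀ x ∈ Ioo 0 a, ∀ y ∈ Ioo 0 a, ⟪E x, E y⟫_ℂ = F (x - y)) :
    ∃ ρ > 0, ∀ ξ : H, ∀ y₀ ∈ Ioo 0 a, (∀ᶠ y in 𝓝 y₀, ⟪ξ, E y⟫_ℂ = 0) →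
      ∀ y ∈ Ioo 0 a, |y - y₀| < ρ → ⟪ξ, E y⟫_ℂ = 0 := by
  obtain ⟨r, hr, R, hR, M, hM, f, rfl, hder, hbd⟩ := hF.exists_derivatives_bound
  -- The estimate `key` has the rate 3|s|/R, which is below 1 exactly within this radius.
  refine ⟨R / 3, by positivity, fun ξ y₀ hy₀ hev y hy hyρ => ?_⟩
  obtain ⟨δ, hδ, hz⟩ := Metric.eventually_nhds_iff.1 hev
  set s := y - y₀ with hs
  obtain ⟨q, hq⟩ := exists_nat_gt (|s| / min δ r)
  have hmin : 0 < min δ r := lt_min hδ hr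
  have hq0 : (0 : ℝ) < q := lt_of_le_of_lt (by positivity) hq
  have hsq : |s| / q < min δ r := by
    rw [div_lt_iff₀ hq0]
    rw [div_lt_iff₀ hmin] at hq
    linarith
  have key : ∀ N : ℕ, 0 < N → ‖⟪ξ, E y⟫_ℂ‖ ≤ ‖ξ‖ * √M * (3 * |s| / R) ^ N := by
    intro N hN
    have hN' : (0 : ℝ) < N := by exact_mod_cast hN
    -- The segment from y₀ to y is cut into qN steps with q fixed. The first N nodes then cover a
    -- length below |s|/q, less than δ, where the pairing vanishes; N|h| is also below r, where the
    -- derivative bounds hold.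
    set m := q * N with hm
    have hm0 : (0 : ℝ) < m := by rw [hm]; push_cast; positivity
    set h := s / m with hh
    have hhN : N * |h| = |s| / q := by
      rw [hh, hm, abs_div, Nat.abs_cast]; push_cast; field_simp
    set v : ℕ → H := fun k => E (y₀ + k * h) with hv
    have hmem : ∀ k ≤ m, y₀ + k * h ∈ Ioo 0 a := fun k hk => by
      have hk' : (k : ℝ) ≤ m := by exact_mod_cast hk
      have := (convex_Ioo (0 : ℝ) a) hy₀ hy (a := 1 - (k : ℝ) / m) (b := (k : ℝ) / m)
        (by rw [sub_nonneg, div_le_one hm0]; exact hk') (by positivity) (by ring)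
      convert this using 1
      simp only [smul_eq_mul, hh, hs]
      ring
    have hgram : ∀ i j, i ≤ m → j ≤ m → ⟪v i, v j⟫_ℂ = f 0 ((i - j) * h) := fun i j hi hj => by
      rw [hv, hE _ (hmem i hi) _ (hmem j hj)]
      congr 1
      ring
    have hD : ∀ k, k + N ≤ m →
        ‖(fwdDiff 1)^[N] v k‖ ≤ √M * (3 * |h| / R) ^ N * N.factorial := fun k hk => by
      have h1 := inner_iterate_fwdDiff hgram N k k (by omega) (by omega)
      have h2 := norm_iterate_negSecondDiff_le (h := h) N (f := f) (r := r) (u := 0) hder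
        (hbd (2 * N)) (by rw [abs_zero, zero_add, hhN]; exact hsq.trans_le (min_le_right _ _))
      rw [sub_self, zero_mul, inner_self_eq_norm_sq_to_K] at h1
      rw [← h1] at h2
      have h3 : ((2 * N).factorial : ℝ) ≤ 4 ^ N * (N.factorial : ℝ) ^ 2 := by
        exact_mod_cast factorial_two_mul_le N
      refine abs_le_of_sq_le_sq' ?_ (by positivity) |>.2
      have h4 : ‖(fwdDiff 1)^[N] v k‖ ^ 2 ≤
          (2 * h ^ 2) ^ N * (M * (2 * N).factorial / R ^ (2 * N)) := by simpa using h2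
      -- The constant 2·4 = 8 is rounded up to 9 = 3² so that the square root is clean.
      calc _ ≤ _ := h4
        _ ≤ (2 * h ^ 2) ^ N * (M * (4 ^ N * (N.factorial : ℝ) ^ 2) / R ^ (2 * N)) := by gcongr
        _ = M * (8 * (h ^ 2 / R ^ 2)) ^ N * (N.factorial : ℝ) ^ 2 := by
          rw [pow_mul R, show 8 * (h ^ 2 / R ^ 2) = 2 * h ^ 2 * 4 / R ^ 2 by ring]
          generalize h ^ 2 = x
          rw [div_pow, mul_pow (2 * x)]
          ring
        _ ≤ M * (9 * (h ^ 2 / R ^ 2)) ^ N * (N.factorial : ℝ) ^ 2 := by gcongr; norm_num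
        _ = _ := by
          rw [mul_pow (√M * _), mul_pow √M, Real.sq_sqrt hM, ← pow_mul, mul_comm N 2, pow_mul,
            div_pow (3 * |h|), mul_pow 3, sq_abs]
          congr 3
          ring
    have h5 := norm_le_choose_mul_of_fwdDiff N (f := fun k => ⟪ξ, v k⟫_ℂ) (K := m)
      (B := ‖ξ‖ * (√M * (3 * |h| / R) ^ N * N.factorial))
      (fun k hk => hz (by
        rw [Real.dist_eq, add_sub_cancel_left, abs_mul, Nat.abs_cast]
        calc (k : ℝ) * |h| ≤ N * |h| := by gcongr
          _ < δ := by rw [hhN]; exact hsq.trans_le (min_le_left _ _)))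
      (fun k hk => by
        rw [inner_iterate_fwdDiff_right]
        exact (norm_inner_le_norm _ _).trans (by gcongr; exact hD k hk)) m le_rfl
    have hvm : v m = E y := by
      rw [hv, hh]
      simp only
      rw [mul_div_cancel₀ _ hm0.ne', hs, add_sub_cancel]
    simp only [hvm] at h5
    have h6 : (m.choose N : ℝ) * N.factorial ≤ (m : ℝ) ^ N := by
      rw [mul_comm]
      exact_mod_cast (Nat.descFactorial_eq_factorial_mul_choose m N).symm.trans_le
        (Nat.descFactorial_le_pow m N)
    -- The N! is absorbed by the binomial coefficient, and m|h| = |s| removes q. This is why the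
    -- radius does not depend on δ.
    calc _ ≤ _ := h5
      _ = ‖ξ‖ * √M * (3 * |h| / R) ^ N * (m.choose N * N.factorial) := by ring
      _ ≤ ‖ξ‖ * √M * (3 * |h| / R) ^ N * (m : ℝ) ^ N := by gcongr
      _ = ‖ξ‖ * √M * (3 * |s| / R) ^ N := by
        rw [mul_assoc, ← mul_pow, hh, abs_div, Nat.abs_cast]
        congr 2
        field_simp
  have hlim : Filter.Tendsto (fun N : ℕ => ‖ξ‖ * √M * (3 * |s| / R) ^ N) Filter.atTop (𝓝 0) := by
    have : 3 * |s| / R < 1 := by rw [div_lt_one hR]; linarith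
    simpa using (tendsto_pow_atTop_nhds_zero_of_lt_one (by positivity) this).const_mul (‖ξ‖ * √M)
  have := ge_of_tendsto hlim (Filter.eventually_atTop.2 ⟨1, fun N hN => key N hN⟩)
  exact norm_le_zero_iff.1 this

/-- Uniqueness of continuation for vectors with translation invariant analytic Gram kernel. -/
theorem inner_eq_zero_of_analyticAt {a : ℝ} {E : ℝ → H} {F : ℝ → ℂ} (hF : AnalyticAt ℝ F 0)
    (hE : ∀ x ∈ Ioo 0 a, ∀ y ∈ Ioo 0 a, ⟪E x, E y⟫_ℂ = F (x - y)) {ξ : H} {U : Set ℝ}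
    (hU : IsOpen U) (hne : (Ioo 0 a ∩ U).Nonempty) (h0 : ∀ y ∈ Ioo 0 a ∩ U, ⟪ξ, E y⟫_ℂ = 0) :
    ∀ y ∈ Ioo 0 a, ⟪ξ, E y⟫_ℂ = 0 := by
  obtain ⟨ρ, hρ, key⟩ := exists_radius_inner_eq_zero hF hE
  set Z : Set ℝ := {y | y ∈ Ioo 0 a ∧ ∀ᶠ x in 𝓝 y, ⟪ξ, E x⟫_ℂ = 0} with hZ
  have hstep : ∀ y₀ ∈ Z, ∀ y ∈ Ioo 0 a, |y - y₀| < ρ → y ∈ Z := fun y₀ hy₀ y hy hd => by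
    refine ⟨hy, ?_⟩
    have h1 : ∀ᶠ x in 𝓝 y, |x - y₀| < ρ :=
      (continuous_abs.comp (continuous_id.sub continuous_const)).continuousAt.eventually_lt_const hd
    filter_upwards [h1, isOpen_Ioo.mem_nhds hy] with x hx hx'
    exact key ξ y₀ hy₀.1 hy₀.2 x hx' hx
  have hsub : Ioo 0 a ⊆ Z := by
    -- Since ρ does not depend on the base point, Z is both open and relatively closed in the
    -- interval.
    refine isPreconnected_Ioo.subset_of_closure_inter_subset ?_ ?_ ?_
    · refine isOpen_iff_mem_nhds.2 fun y hy => ?_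
      filter_upwards [isOpen_Ioo.mem_nhds hy.1, Metric.ball_mem_nhds y hρ] with x hx hd
      exact hstep y hy x hx (by simpa [Real.dist_eq] using hd)
    · obtain ⟨y, hy, hyU⟩ := hne
      refine ⟨y, hy, hy, ?_⟩
      filter_upwards [isOpen_Ioo.mem_nhds hy, hU.mem_nhds hyU] with x hx hx'
      exact h0 x ⟨hx, hx'⟩
    · rintro y ⟨hyc, hy⟩
      obtain ⟨z, hz, hd⟩ := Metric.mem_closure_iff.1 hyc ρ hρ
      exact hstep z hz y hy (by simpa [Real.dist_eq] using hd)
  exact fun y hy => (hsub hy).2.self_of_nhds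

end

/-! ### Isometries from Gram kernels, and unitary groups from local data -/

section

variable {H : Type*} [NormedAddCommGroup H] [InnerProductSpace ℂ H]
  {K : Type*} [NormedAddCommGroup K] [InnerProductSpace ℂ K]

theorem LinearIsometryEquiv.mul_apply_eq (A B : H ≃ₗᵢ[ℂ] H) (ξ : H) : (A * B) ξ = A (B ξ) := rfl

theorem dense_span_of_forall_inner_eq_zero [CompleteSpace H] {s : Set H}
    (hs : ∀ ξ : H, (∀ x ∈ s, ⟪ξ, x⟫_ℂ = 0) → ξ = 0) : Dense (Submodule.span ℂ s : Set H) := by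
  rw [Submodule.dense_iff_topologicalClosure_eq_top, Submodule.topologicalClosure_eq_top_iff,
    Submodule.eq_bot_iff]
  intro ξ hξ
  exact hs ξ fun x hx => (Submodule.mem_orthogonal' _ _).1 hξ x (Submodule.subset_span hx)

/-- Two families with the same Gram matrix, the first of which is total, are related by a linear
isometry. -/
theorem exists_linearIsometry_of_inner_eq [CompleteSpace K] {ι : Type*} {f : ι → H} {g : ι → K}
    (hf : Dense (Submodule.span ℂ (range f) : Set H))
    (hfg : ∀ i j, ⟪f i, f j⟫_ℂ = ⟪g i, g j⟫_ℂ) : ∃ W : H →ₗᵢ[ℂ] K, ∀ i, W (f i) = g i := by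
  set φ := Finsupp.linearCombination ℂ f with hφ
  set γ := Finsupp.linearCombination ℂ g with hγ
  have hd : DenseRange φ := by
    rw [DenseRange, ← LinearMap.coe_range, hφ, Finsupp.range_linearCombination]
    exact hf
  -- The norm of a finite combination depends only on its coefficients and the Gram matrix; density
  -- then gives the extension.
  have hn : ∀ c, ‖γ c‖ = ‖φ c‖ := fun c => by
    rw [@norm_eq_sqrt_re_inner ℂ, @norm_eq_sqrt_re_inner ℂ _ _ _ _ (φ c), hφ, hγ]
    simp only [Finsupp.linearCombination_apply, Finsupp.sum_inner, Finsupp.inner_sum,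
      inner_smul_left, inner_smul_right, hfg]
  have heq := LinearMap.extendOfNorm_eq (f := γ) hd ⟨1, fun c => by rw [one_mul, hn]⟩
  refine ⟨⟨(γ.extendOfNorm φ).toLinearMap, fun x => ?_⟩, fun i => ?_⟩
  · refine hd.induction_on (p := fun x => ‖γ.extendOfNorm φ x‖ = ‖x‖) x
      (isClosed_eq (by fun_prop) (by fun_prop)) fun c => ?_
    rw [heq, hn]
  · have := heq (Finsupp.single i 1)
    simpa [hφ, hγ] using this

/-! ### From local translations to a unitary group -/

/-- A local one-parameter subgroup extends to a one-parameter subgroup. -/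
theorem exists_hom_extension {G : Type*} [Group G] {δ : ℝ} (hδ : 0 < δ) {S : ℝ → G}
    (hS : ∀ s t, |s| < δ → |t| < δ → |s + t| < δ → S (s + t) = S s * S t) :
    ∃ V : ℝ → G, (∀ s t, V (s + t) = V s * V t) ∧ ∀ t, |t| < δ → V t = S t := by
  have hpow : ∀ (n : ℕ) t, n * |t| < δ → S (n * t) = S t ^ n := by
    intro n
    induction n with
    | zero =>
      intro t _
      have := hS 0 0 (by simpa) (by simpa) (by simpa)
      simpa using this
    | succ n ih =>
      intro t ht
      push_cast at ht ⊢
      have h1 : n * |t| < δ := by nlinarith [abs_nonneg t]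
      have h2 : |t| < δ := by nlinarith [abs_nonneg t, (Nat.cast_nonneg n : (0 : ℝ) ≤ n)]
      rw [pow_succ, ← ih t h1, add_mul, one_mul, hS _ _ _ h2]
      · rw [← add_one_mul, abs_mul, abs_of_nonneg (by positivity)]
        exact ht
      · rwa [abs_mul, Nat.abs_cast]
  -- Every n ≥ k t brings t/n below δ, and k t = 1 if |t| < δ. The candidate S(t/k)^k therefore
  -- restricts to S; `hind` shows independence of the subdivision by passing to a common multiple.
  set k : ℝ → ℕ := fun t => ⌊|t| / δ⌋₊ + 1 with hk
  have hk1 : ∀ t (n : ℕ), k t ≤ n → |t / n| < δ := fun t n hn => by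
    have h1 : |t| / δ < n := (Nat.lt_floor_add_one _).trans_le (by exact_mod_cast hn)
    have h2 : (0 : ℝ) < n := lt_of_le_of_lt (by positivity) h1
    rw [abs_div, Nat.abs_cast, div_lt_iff₀ h2]
    rw [div_lt_iff₀ hδ] at h1
    linarith
  have hk0 : ∀ t (n : ℕ), k t ≤ n → (n : ℝ) ≠ 0 := fun t n hn => by
    have : 1 ≤ k t := by simp [hk]
    exact_mod_cast (by omega : n ≠ 0)
  have hind : ∀ t (n : ℕ), k t ≤ n → S (t / n) ^ n = S (t / k t) ^ k t := by
    have aux : ∀ t (n m : ℕ), k t ≤ n → 1 ≤ m → S (t / (n * m : ℕ)) ^ (n * m) = S (t / n) ^ n := by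
      intro t n m hn hm
      have hm0 : (m : ℝ) ≠ 0 := by exact_mod_cast (by omega : m ≠ 0)
      have hn0 := hk0 t n hn
      rw [mul_comm n m, pow_mul, ← hpow m]
      · congr 2
        push_cast
        field_simp
      · have := hk1 t n hn
        rw [← Nat.abs_cast m, ← abs_mul]
        have h2 : (m : ℝ) * (t / (m * n : ℕ)) = t / n := by
          push_cast
          field_simp
        rwa [h2]
    intro t n hn
    have h1 : 1 ≤ k t := by simp [hk]
    rw [← aux t n (k t) hn h1, ← aux t (k t) n le_rfl (by omega), mul_comm]
  have hcomm : ∀ s t, |s| < δ → |t| < δ → |s + t| < δ → Commute (S s) (S t) :=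
    fun s t hs ht hst => by
      rw [Commute, SemiconjBy, ← hS s t hs ht hst, ← hS t s ht hs (by rwa [add_comm]), add_comm]
  refine ⟨fun t => S (t / k t) ^ k t, fun s t => ?_, fun t ht => ?_⟩
  · set n := k s + k t + k (s + t) with hn
    simp only
    rw [← hind s n (by omega), ← hind t n (by omega), ← hind (s + t) n (by omega)]
    have h1 := hk1 s n (by omega)
    have h2 := hk1 t n (by omega)
    have h3 := hk1 (s + t) n (by omega)
    rw [add_div] at h3 ⊢
    rw [hS _ _ h1 h2 h3, (hcomm _ _ h1 h2 h3).mul_pow]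
  · have : k t = 1 := by
      simp only [hk]
      rw [Nat.floor_eq_zero.2 ((div_lt_one hδ).2 ht)]
    simp [this]

/-- Shifting the middle third by |t| < a/3 keeps it in Ω and preserves the Gram kernel, so totality
of the middle third yields an isometry of H. The composition law needs checking only on an open
overlap, which is again total. For larger |t| the value is an irrelevant default. -/
theorem exists_local_translations [CompleteSpace H] {a : ℝ} (ha : 0 < a) {E : ℝ → H} {F : ℝ → ℂ}
    (hE : ∀ x ∈ Ioo 0 a, ∀ y ∈ Ioo 0 a, ⟪E x, E y⟫_ℂ = F (x - y))
    (hdense : ∀ U : Set ℝ, IsOpen U → (Ioo 0 a ∩ U).Nonempty →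
      Dense (Submodule.span ℂ (range fun y : ↥(Ioo 0 a ∩ U) => E y) : Set H)) :
    ∃ S : ℝ → H ≃ₗᵢ[ℂ] H,
      (∀ s t, |s| < a / 3 → |t| < a / 3 → |s + t| < a / 3 → S (s + t) = S s * S t) ∧
      ∀ t, |t| < a / 3 → ∀ y ∈ Ioo 0 a ∩ Ioo (a / 3) (2 * a / 3), S t (E y) = E (y - t) := by
  have hext : ∀ {A B : H →L[ℂ] H} (U : Set ℝ), IsOpen U → (Ioo 0 a ∩ U).Nonempty →
      (∀ y ∈ Ioo 0 a ∩ U, A (E y) = B (E y)) → A = B := by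
    intro A B U hU hne h
    refine ContinuousLinearMap.ext_on (hdense U hU hne) ?_
    rintro _ ⟨y, rfl⟩
    exact h y y.2
  set J : Set ℝ := Ioo (a / 3) (2 * a / 3) with hJ
  have hJΩ : ∀ t, |t| < a / 3 → ∀ y ∈ Ioo 0 a ∩ J, y - t ∈ Ioo 0 a := by
    rintro t ht y ⟨-, hy1, hy2⟩
    obtain ⟨h1, h2⟩ := abs_lt.1 ht
    constructor <;> linarith
  have hJne : ∀ t, |t| < a / 3 → (Ioo 0 a ∩ (J ∩ {y | y - t ∈ J})).Nonempty := by
    intro t ht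
    obtain ⟨h1, h2⟩ := abs_lt.1 ht
    -- This is the midpoint of the overlap of J with J + t.
    refine ⟨a / 2 + t / 2, ⟨?_, ?_⟩, ⟨?_, ?_⟩, ?_, ?_⟩ <;> linarith
  have hJo : ∀ t, IsOpen (J ∩ {y : ℝ | y - t ∈ J}) := fun t =>
    isOpen_Ioo.inter (isOpen_Ioo.preimage (by fun_prop))
  have hJ0 : (Ioo 0 a ∩ J).Nonempty := by
    refine ⟨a / 2, ⟨?_, ?_⟩, ?_, ?_⟩ <;> linarith
  have hiso : ∀ t, ∃ W : H →ₗᵢ[ℂ] H, |t| < a / 3 → ∀ y ∈ Ioo 0 a ∩ J, W (E y) = E (y - t) := by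
    intro t
    by_cases ht : |t| < a / 3
    · obtain ⟨W, hW⟩ := exists_linearIsometry_of_inner_eq (f := fun y : ↥(Ioo 0 a ∩ J) => E y)
        (hdense J isOpen_Ioo hJ0) (g := fun y => E (y - t)) fun x y => by
          rw [hE _ x.2.1 _ y.2.1, hE _ (hJΩ t ht _ x.2) _ (hJΩ t ht _ y.2)]
          congr 1
          ring
      exact ⟨W, fun _ y hy => hW ⟨y, hy⟩⟩
    · exact ⟨LinearIsometry.id, fun h => absurd h ht⟩
  choose W hW using hiso
  have hWadd : ∀ s t, |s| < a / 3 → |t| < a / 3 → |s + t| < a / 3 → ∀ ξ,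
      W (s + t) ξ = W s (W t ξ) := by
    intro s t hs ht hst ξ
    have := hext (A := (W (s + t)).toContinuousLinearMap)
      (B := (W s).toContinuousLinearMap ∘L (W t).toContinuousLinearMap) _ (hJo t) (hJne t ht)
      fun y hy => by
        simp only [LinearIsometry.coe_toContinuousLinearMap, ContinuousLinearMap.comp_apply]
        rw [hW _ hst _ ⟨hy.1, hy.2.1⟩, hW _ ht _ ⟨hy.1, hy.2.1⟩,
          hW _ hs _ ⟨hJΩ t ht y ⟨hy.1, hy.2.1⟩, hy.2.2⟩]
        congr 1
        ring
    exact congrArg (fun A : H →L[ℂ] H => A ξ) this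
  have hW0 : ∀ ξ, W 0 ξ = ξ := by
    intro ξ
    have := hext (A := (W 0).toContinuousLinearMap) (B := ContinuousLinearMap.id ℂ H) _
      isOpen_Ioo hJ0 fun y hy => by
        simpa using hW 0 (by simpa) y hy
    exact congrArg (fun A : H →L[ℂ] H => A ξ) this
  have hequiv : ∀ t, ∃ S : H ≃ₗᵢ[ℂ] H, |t| < a / 3 → ∀ ξ, S ξ = W t ξ := by
    intro t
    by_cases ht : |t| < a / 3
    · refine ⟨LinearIsometryEquiv.ofSurjective (W t) fun ξ => ⟨W (-t) ξ, ?_⟩, fun _ ξ => rfl⟩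
      rw [← hWadd t (-t) ht (by simpa) (by simpa), add_neg_cancel, hW0]
    · exact ⟨LinearIsometryEquiv.refl ℂ H, fun h => absurd h ht⟩
  choose S hSW using hequiv
  refine ⟨S, fun s t hs ht hst => ?_, fun t ht y hy => by rw [hSW t ht, hW t ht y hy]⟩
  ext ξ
  rw [hSW _ hst, LinearIsometryEquiv.mul_apply_eq, hSW _ hs, hSW _ ht, hWadd s t hs ht hst]

/-- A local translation group on a total family of vectors with translation invariant Gram kernel
extends to a unitary group. -/
theorem exists_unitaryGroup [CompleteSpace H] {a : ℝ} (ha : 0 < a) {E : ℝ → H} {F : ℝ → ℂ}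
    (hF : AnalyticAt ℝ F 0)
    (hE : ∀ x ∈ Ioo 0 a, ∀ y ∈ Ioo 0 a, ⟪E x, E y⟫_ℂ = F (x - y))
    (hcont : ContinuousOn E (Ioo 0 a))
    (htot : ∀ ξ : H, (∀ y ∈ Ioo 0 a, ⟪ξ, E y⟫_ℂ = 0) → ξ = 0) :
    ∃ V : UnitaryGroup H, ∀ t, ∀ y ∈ Ioo 0 a, y - t ∈ Ioo 0 a → V.U t (E y) = E (y - t) := by
  have hdense : ∀ U : Set ℝ, IsOpen U → (Ioo 0 a ∩ U).Nonempty →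
      Dense (Submodule.span ℂ (range fun y : ↥(Ioo 0 a ∩ U) => E y) : Set H) := by
    intro U hU hne
    refine dense_span_of_forall_inner_eq_zero fun ξ hξ => htot ξ ?_
    refine inner_eq_zero_of_analyticAt hF hE hU hne fun y hy => hξ _ ⟨⟨y, hy⟩, rfl⟩
  set J : Set ℝ := Ioo (a / 3) (2 * a / 3) with hJ
  have hJΩ : ∀ t, |t| < a / 3 → ∀ y ∈ Ioo 0 a ∩ J, y - t ∈ Ioo 0 a := by
    rintro t ht y ⟨-, hy1, hy2⟩
    obtain ⟨h1, h2⟩ := abs_lt.1 ht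
    constructor <;> linarith
  have hJ0 : (Ioo 0 a ∩ J).Nonempty := by
    refine ⟨a / 2, ⟨?_, ?_⟩, ?_, ?_⟩ <;> linarith
  obtain ⟨S, hSadd, hSE⟩ := exists_local_translations ha hE hdense
  obtain ⟨V, hVadd, hVS⟩ := exists_hom_extension (by positivity : 0 < a / 3) hSadd
  have hV0 : V 0 = 1 := by simpa using hVadd 0 0
  have hVJ : ∀ t, |t| < a / 3 → ∀ y ∈ Ioo 0 a ∩ J, V t (E y) = E (y - t) := fun t ht y hy => by
    rw [hVS t ht, hSE t ht y hy]
  have hVinv : ∀ t ξ η, ⟪ξ, V t η⟫_ℂ = ⟪V (-t) ξ, η⟫_ℂ := fun t ξ η => by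
    rw [← (V (-t)).inner_map_map ξ, ← LinearIsometryEquiv.mul_apply_eq, ← hVadd, neg_add_cancel, hV0]
    rfl
  -- For y outside the middle third, V t is moved by unitarity to test vectors E z with z in the
  -- middle third, where its action is known and which are total.
  have hsmall : ∀ t, |t| < a / 3 → ∀ y ∈ Ioo 0 a, y - t ∈ Ioo 0 a → V t (E y) = E (y - t) := by
    intro t ht y hy hyt
    refine (hdense J isOpen_Ioo hJ0).eq_of_inner_right ℂ fun ξ hξ => ?_
    refine Submodule.span_induction ?_ (by simp) (fun _ _ _ _ h1 h2 => by
      rw [inner_add_left, inner_add_left, h1, h2]) (fun c _ _ h => by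
      rw [inner_smul_left, inner_smul_left, h]) hξ
    rintro _ ⟨z, rfl⟩
    have hz := hJΩ (-t) (by simpa) z z.2
    rw [hVinv, hVJ _ (by simpa) _ z.2, hE _ hz _ hy, hE _ z.2.1 _ hyt]
    congr 1
    ring
  have hVE : ∀ t, ∀ y ∈ Ioo 0 a, y - t ∈ Ioo 0 a → V t (E y) = E (y - t) := by
    intro t y hy hyt
    have ht : |t| < a := by
      rw [abs_lt]
      constructor <;> linarith [hy.1, hy.2, hyt.1, hyt.2]
    -- Three steps of length t/3 suffice; convexity keeps the intermediate points in the interval.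
    have ht3 : |t / 3| < a / 3 := by
      rw [abs_div, abs_of_pos (by norm_num : (0 : ℝ) < 3)]
      linarith
    have hc : ∀ l : ℝ, 0 ≤ l → l ≤ 1 → y - l * t ∈ Ioo 0 a := fun l h0 h1 => by
      have := convex_Ioo (0 : ℝ) a hy hyt (a := 1 - l) (b := l) (by linarith) h0 (by ring)
      convert this using 1
      simp only [smul_eq_mul]
      ring
    have h1 := hc (1 / 3) (by norm_num) (by norm_num)
    have h2 := hc (2 / 3) (by norm_num) (by norm_num)
    rw [show 1 / 3 * t = t / 3 by ring] at h1
    rw [show y - 2 / 3 * t = y - t / 3 - t / 3 by ring] at h2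
    have h3 : y - t = y - t / 3 - t / 3 - t / 3 := by ring
    rw [show t = t / 3 + (t / 3 + t / 3) by ring, hVadd, hVadd, LinearIsometryEquiv.mul_apply_eq,
      LinearIsometryEquiv.mul_apply_eq, hsmall _ ht3 _ hy h1, hsmall _ ht3 _ h1 h2,
      hsmall _ ht3 _ h2 (h3 ▸ hyt)]
    congr 1
    ring
  have hc0 : ∀ ξ, Filter.Tendsto (fun t => V t ξ) (𝓝 0) (𝓝 ξ) := by
    intro ξ
    have hspan : ∀ η ∈ Submodule.span ℂ (range fun y : ↥(Ioo 0 a ∩ J) => E y),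
        Filter.Tendsto (fun t => V t η) (𝓝 0) (𝓝 η) := by
      intro η hη
      refine Submodule.span_induction ?_ (by simp) (fun _ _ _ _ h1 h2 => by
        simpa using h1.add h2) (fun c _ _ h => by simpa using h.const_smul c) hη
      rintro _ ⟨y, rfl⟩
      have h1 : Filter.Tendsto (fun t : ℝ => (y : ℝ) - t) (𝓝 0) (𝓝 y) := by
        have : Continuous fun t : ℝ => (y : ℝ) - t := by fun_prop
        simpa using this.tendsto 0
      have h2 := (hcont.continuousAt (isOpen_Ioo.mem_nhds y.2.1)).tendsto.comp h1
      refine h2.congr' ?_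
      filter_upwards [h1.eventually (isOpen_Ioo.mem_nhds y.2.1)] with t ht
      exact (hVE t y y.2.1 ht).symm
    rw [Metric.tendsto_nhds]
    intro ε hε
    obtain ⟨η, hη, hd⟩ := Metric.mem_closure_iff.1 (hdense J isOpen_Ioo hJ0 ξ) (ε / 3)
      (by positivity)
    filter_upwards [Metric.tendsto_nhds.1 (hspan η hη) (ε / 3) (by positivity)] with t ht
    calc dist (V t ξ) ξ ≤ dist (V t ξ) (V t η) + dist (V t η) η + dist η ξ := dist_triangle4 _ _ _ _
      _ < ε := by
        rw [(V t).dist_map, dist_comm η ξ]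
        linarith
  refine ⟨⟨V, fun ξ => by rw [hV0]; rfl, fun s t ξ => by rw [hVadd]; rfl, fun ξ => ?_⟩, hVE⟩
  rw [continuous_iff_continuousAt]
  intro t
  have h1 : Filter.Tendsto (fun s : ℝ => s - t) (𝓝 t) (𝓝 0) := by
    have : Continuous fun s : ℝ => s - t := by fun_prop
    simpa using this.tendsto t
  have h2 := (hc0 (V t ξ)).comp h1
  refine h2.congr fun s => ?_
  simp only [Function.comp]
  rw [← LinearIsometryEquiv.mul_apply_eq, ← hVadd, sub_add_cancel]

end

/-! ### A criterion for essential skew-adjointness -/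

section

variable {H : Type*} [NormedAddCommGroup H] [InnerProductSpace ℂ H]

theorem UnitaryGroup.inner_apply_left (V : UnitaryGroup H) (t : ℝ) (ξ η : H) :
    ⟪V.U t ξ, η⟫_ℂ = ⟪ξ, V.U (-t) η⟫_ℂ := by
  rw [← (V.U (-t)).inner_map_map, ← V.map_add, neg_add_cancel, V.map_zero]

theorem UnitaryGroup.inner_add_inner_eq_zero (V : UnitaryGroup H) {ξ η ξ' η' : H}
    (hξ : HasDerivAt (fun t : ℝ => V.U t ξ) ξ' 0) (hη : HasDerivAt (fun t : ℝ => V.U t η) η' 0) :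
    ⟪ξ', η⟫_ℂ + ⟪ξ, η'⟫_ℂ = 0 := by
  have h := hξ.inner ℂ hη
  simp only [LinearIsometryEquiv.inner_map_map, V.map_zero] at h
  rw [add_comm]
  exact h.unique (hasDerivAt_const _ _)

variable [CompleteSpace H]

/-- If the orbits of a total set stay in the domain for a short time, the generator of the group
extends `-T†`. -/
theorem UnitaryGroup.hasDerivAt_neg_adjoint (V : UnitaryGroup H) {T : H →ₗ.[ℂ] H}
    (hT : Dense (T.domain : Set H)) (hV : V.GeneratorExtends T) {S : Set H} {δ : ℝ} (hδ : 0 < δ)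
    (hS : ∀ x ∈ S, ∀ t, |t| < δ → V.U t x ∈ T.domain)
    (htot : ∀ ξ : H, (∀ x ∈ S, ⟪ξ, x⟫_ℂ = 0) → ξ = 0) (ξ : T†.domain) :
    HasDerivAt (fun t : ℝ => V.U t (ξ : H)) (-(T† ξ)) 0 := by
  set η := T† ξ with hη
  have hint : ∀ t : ℝ, HasDerivAt (fun t : ℝ => ∫ s in (0 : ℝ)..t, V.U s η) (V.U t η) t :=
    fun t => ((V.continuous η).integral_hasStrictDerivAt 0 t).hasDerivAt
  have horb : ∀ x (hx : x ∈ S) t (ht : |t| < δ),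
      HasDerivAt (fun t : ℝ => V.U t x) (T ⟨V.U t x, hS x hx t ht⟩) t := by
    intro x hx t ht
    have h1 := hV ⟨V.U t x, hS x hx t ht⟩
    simp only [← V.map_add] at h1
    rw [← sub_self t] at h1
    simpa using h1.comp_sub_const t t
  -- Against x in S the pairing has zero derivative: the group is moved onto x, whose orbit stays in
  -- the domain, and there T is exchanged for its adjoint. Totality of S gives the integrated
  -- equation, which is then differentiated at 0.
  have hzero : ∀ t, |t| < δ → V.U t (ξ : H) - ξ + ∫ s in (0 : ℝ)..t, V.U s η = 0 := by
    intro t ht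
    refine htot _ fun x hx => ?_
    have hder : ∀ t ∈ Metric.ball (0 : ℝ) δ, HasDerivWithinAt
        (fun t => ⟪V.U t (ξ : H) - ξ + ∫ s in (0 : ℝ)..t, V.U s η, x⟫_ℂ) 0
        (Metric.ball 0 δ) t := by
      intro t ht
      replace ht : |-t| < δ := by simpa using ht
      have h1 := ((innerSL ℂ (ξ : H)).hasFDerivAt.restrictScalars ℝ).comp_hasDerivAt (-t)
        (horb x hx (-t) ht)
      have h2 : HasDerivAt (fun t => ⟪V.U t (ξ : H), x⟫_ℂ) (-⟪V.U t η, x⟫_ℂ) t := by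
        have h3 := h1.scomp t (hasDerivAt_neg t)
        simp only [V.inner_apply_left]
        have h4 := LinearPMap.adjoint_isFormalAdjoint hT ξ ⟨V.U (-t) x, hS x hx _ ht⟩
        rw [hη, h4]
        refine h3.congr_deriv ?_
        simp
      have h5 := (hint t).inner ℂ (hasDerivAt_const t x)
      have h6 := (h2.sub_const ⟪(ξ : H), x⟫_ℂ).add h5
      simp only [inner_zero_right, zero_add, neg_add_cancel] at h6
      refine (h6.congr_of_eventuallyEq (Filter.Eventually.of_forall fun s => ?_)).hasDerivWithinAt
      simp only [inner_add_left, inner_sub_left, Pi.add_apply]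
    have := (convex_ball (0 : ℝ) δ).norm_image_sub_le_of_norm_hasDerivWithin_le hder
      (fun _ _ => (norm_zero (E := ℂ)).le) (Metric.mem_ball_self hδ) (y := t) (by simpa using ht)
    simpa [V.map_zero] using this
  have h1 := (hint 0).neg.const_add (ξ : H)
  rw [V.map_zero] at h1
  refine h1.congr_of_eventuallyEq ?_
  filter_upwards [Metric.ball_mem_nhds (0 : ℝ) hδ] with t ht
  have := hzero t (by simpa using ht)
  simp only [Pi.neg_apply]
  rw [← sub_eq_zero, ← this]
  abel

theorem LinearPMap.mem_graph_adjoint_iff {T : H →ₗ.[ℂ] H} (hT : Dense (T.domain : Set H))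
    {u v : H} : (u, v) ∈ T†.graph ↔ ∀ x : T.domain, ⟪T x, u⟫_ℂ = ⟪(x : H), v⟫_ℂ := by
  rw [LinearPMap.adjoint_graph_eq_graph_adjoint hT, Submodule.mem_adjoint_iff]
  constructor
  · intro h x
    exact sub_eq_zero.1 (h x (T x) (T.mem_graph x))
  · rintro h a b hab
    obtain ⟨x, rfl, rfl⟩ := T.mem_graph_iff.1 hab
    exact sub_eq_zero.2 (h x)

/-- A densely defined skew-symmetric operator with skew-symmetric adjoint is essentially
skew-adjoint. -/
theorem isEssentiallySkewAdjoint_of_adjoint_skew {T : H →ₗ.[ℂ] H}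
    (hT : Dense (T.domain : Set H)) (hskew : ∀ x y : T.domain, ⟪T x, y⟫_ℂ + ⟪(x : H), T y⟫_ℂ = 0)
    (hadj : ∀ x y : T†.domain, ⟪T† x, y⟫_ℂ + ⟪(x : H), T† y⟫_ℂ = 0) :
    IsEssentiallySkewAdjoint T := by
  have hneg : ∀ u v, (u, v) ∈ (-T†).graph ↔ (u, -v) ∈ T†.graph := by
    intro u v
    simp only [LinearPMap.mem_graph_iff, LinearPMap.neg_apply]
    constructor
    · rintro ⟨y, h1, h2⟩
      exact ⟨y, h1, by rw [← h2, neg_neg]⟩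
    · rintro ⟨y, h1, h2⟩
      exact ⟨y, h1, by rw [h2, neg_neg]⟩
  have hgraph : T.graph.topologicalClosure = (-T†).graph := by
    refine le_antisymm ?_ ?_
    · refine Submodule.topologicalClosure_minimal _ ?_ ?_
      · rintro ⟨u, v⟩ huv
        obtain ⟨x, rfl, rfl⟩ := T.mem_graph_iff.1 huv
        rw [hneg, LinearPMap.mem_graph_adjoint_iff hT]
        intro y
        rw [inner_neg_right]
        exact eq_neg_of_add_eq_zero_left (hskew y x)
      · have : ((-T†).graph : Set (H × H)) = (fun p : H × H => (p.1, -p.2)) ⁻¹' T†.graph := by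
          ext ⟨u, v⟩
          exact hneg u v
        rw [this]
        exact IsClosed.preimage (by fun_prop) (LinearPMap.adjoint_isClosed hT)
    · rintro ⟨ξ, η⟩ hp
      rw [hneg, LinearPMap.mem_graph_iff] at hp
      obtain ⟨ζ, rfl, hζ⟩ := hp
      -- In the Hilbert sum the closure of the graph is its double orthogonal complement. If (q₁,
      -- q₂) is orthogonal to the graph of T, then (q₂, -q₁) lies in the graph of the adjoint, and
      -- skew-symmetry of the adjoint makes it orthogonal to (ζ, η).
      set g := T.graph.map (WithLp.linearEquiv 2 ℂ (H × H)).symm.toLinearMap with hg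
      have hmem : WithLp.toLp 2 ((ζ : H), η) ∈ gᗮᗮ := by
        rw [Submodule.mem_orthogonal]
        intro q hq
        have h1 : (q.snd, -q.fst) ∈ T†.graph := by
          rw [LinearPMap.mem_graph_adjoint_iff hT]
          intro x
          have := (Submodule.mem_orthogonal _ _).1 hq (WithLp.toLp 2 ((x : H), T x))
            ⟨_, T.mem_graph x, rfl⟩
          rw [WithLp.prod_inner_apply] at this
          rw [inner_neg_right]
          exact eq_neg_of_add_eq_zero_right this
        obtain ⟨y, hy1, hy2⟩ := T†.mem_graph_iff.1 h1
        have h2 := hadj y ζ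
        rw [hy1, hy2, hζ] at h2
        rw [WithLp.prod_inner_apply]
        simp only [inner_neg_left, inner_neg_right, ← neg_add] at h2
        exact neg_eq_zero.1 h2
      rw [Submodule.orthogonal_orthogonal_eq_closure] at hmem
      have h3 : ((ζ : H), η) ∈ WithLp.ofLp '' closure (g : Set (WithLp 2 (H × H))) :=
        ⟨_, hmem, rfl⟩
      refine closure_mono ?_ (image_closure_subset_closure_image
        (WithLp.prod_continuous_ofLp 2 H H) h3)
      rintro _ ⟨_, ⟨q, hq, rfl⟩, rfl⟩
      exact hq
  have hcl : T.IsClosable := ⟨_, hgraph⟩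
  have hclo : T.closure = -T† :=
    LinearPMap.eq_of_eq_graph (hcl.graph_closure_eq_closure_graph.symm.trans hgraph)
  have hdc : Dense (T.closure.domain : Set H) := hT.mono T.le_closure.1
  have hadjc : T.closure† = T† := by
    refine LinearPMap.eq_of_eq_graph ?_
    ext ⟨u, v⟩
    rw [LinearPMap.mem_graph_adjoint_iff hdc, LinearPMap.mem_graph_adjoint_iff hT]
    constructor
    · intro h x
      have := h ⟨x, T.le_closure.1 x.2⟩
      rwa [← T.le_closure.2 (x := x) (y := ⟨x, T.le_closure.1 x.2⟩) rfl] at this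
    · intro h x
      have hx : ((x : H), T.closure x) ∈ closure (T.graph : Set (H × H)) := by
        have := T.closure.mem_graph x
        rwa [← hcl.graph_closure_eq_closure_graph] at this
      have hc : IsClosed {p : H × H | ⟪p.2, u⟫_ℂ = ⟪p.1, v⟫_ℂ} :=
        isClosed_eq (by fun_prop) (by fun_prop)
      refine closure_minimal (fun p hp => ?_) hc hx
      obtain ⟨y, hy1, hy2⟩ := T.mem_graph_iff.1 hp
      have := h y
      rwa [hy1, hy2] at this
  exact ⟨hT, hcl, by rw [hadjc, hclo]⟩

/-- Pairing T†ξ = cξ with ξ gives (c̄ + c)‖ξ‖² = 0. -/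
theorem adjointEigenspace_eq_bot {T : H →ₗ.[ℂ] H}
    (hadj : ∀ x y : T†.domain, ⟪T† x, y⟫_ℂ + ⟪(x : H), T† y⟫_ℂ = 0) {c : ℂ}
    (hc : conj c + c ≠ 0) : adjointEigenspace T c = ⊥ := by
  rw [Submodule.eq_bot_iff]
  rintro _ ⟨ξ, hξ, rfl⟩
  have h1 : T† ξ = c • (ξ : H) := by
    have := LinearMap.mem_ker.1 hξ
    rw [LinearMap.sub_apply, sub_eq_zero] at this
    exact this
  have h2 := hadj ξ ξ
  rw [h1, inner_smul_left, inner_smul_right, ← add_mul] at h2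
  exact inner_self_eq_zero.1 ((mul_eq_zero.1 h2).resolve_left hc)

/-- If the generator of a unitary group extends `T` and the orbits of a total set stay in the domain
of `T` for a short time, then `T` is essentially skew-adjoint. -/
theorem UnitaryGroup.isEssentiallySkewAdjoint (V : UnitaryGroup H) {T : H →ₗ.[ℂ] H}
    (hV : V.GeneratorExtends T) {S : Set H} {δ : ℝ} (hδ : 0 < δ)
    (hS : ∀ x ∈ S, ∀ t, |t| < δ → V.U t x ∈ T.domain)
    (htot : ∀ ξ : H, (∀ x ∈ S, ⟪ξ, x⟫_ℂ = 0) → ξ = 0) :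
    IsEssentiallySkewAdjoint T ∧ deficiencyIndices T = (0, 0) := by
  have hT : Dense (T.domain : Set H) := by
    rw [Submodule.dense_iff_topologicalClosure_eq_top, Submodule.topologicalClosure_eq_top_iff,
      Submodule.eq_bot_iff]
    refine fun ξ hξ => htot ξ fun x hx => (Submodule.mem_orthogonal' _ _).1 hξ x ?_
    simpa [V.map_zero] using hS x hx 0 (by simpa using hδ)
  have hadj : ∀ x y : T†.domain, ⟪T† x, y⟫_ℂ + ⟪(x : H), T† y⟫_ℂ = 0 := fun x y => by
    have := V.inner_add_inner_eq_zero (V.hasDerivAt_neg_adjoint hT hV hδ hS htot x)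
      (V.hasDerivAt_neg_adjoint hT hV hδ hS htot y)
    rw [inner_neg_left, inner_neg_right, ← neg_add] at this
    exact neg_eq_zero.1 this
  refine ⟨isEssentiallySkewAdjoint_of_adjoint_skew hT
    (fun x y => V.inner_add_inner_eq_zero (hV x) (hV y)) hadj, ?_⟩
  rw [deficiencyIndices, adjointEigenspace_eq_bot hadj (by norm_num),
    adjointEigenspace_eq_bot hadj (by norm_num), rank_bot]

end

/-! ### Bochner's theorem for matrix coefficients of unitary groups -/

section

variable {H : Type*} [NormedAddCommGroup H] [InnerProductSpace ℂ H]

theorem integral_exp_int_mul_I (n : ℤ) :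
    ∫ θ in (-Real.pi)..Real.pi, Complex.exp (n * θ * Complex.I) =
      if n = 0 then (2 * Real.pi : ℂ) else 0 := by
  split_ifs with hn
  · simp [hn]
    ring
  · have hc : (n : ℂ) * Complex.I ≠ 0 := mul_ne_zero (by exact_mod_cast hn) Complex.I_ne_zero
    have h1 : ∀ θ : ℝ, Complex.exp (n * θ * Complex.I) = Complex.exp (n * Complex.I * θ) :=
      fun θ => by ring_nf
    simp only [h1]
    rw [integral_exp_mul_complex hc, div_eq_zero_iff]
    left
    rw [sub_eq_zero, Complex.exp_eq_exp_iff_exists_int]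
    refine ⟨n, ?_⟩
    push_cast
    ring

/-- The Fejér trigonometric sum of the orbit of `ξ`. -/
noncomputable def orbitSum (A : ℕ → H) (N : ℕ) (θ : ℝ) : H :=
  ∑ k ∈ Finset.range N, Complex.exp (-(k * θ * Complex.I)) • A k

theorem continuous_orbitSum (A : ℕ → H) (N : ℕ) : Continuous (orbitSum A N) := by
  unfold orbitSum
  fun_prop

theorem exp_mul_norm_orbitSum_sq (A : ℕ → H) (N j : ℕ) (θ : ℝ) :
    Complex.exp (j * θ * Complex.I) * (‖orbitSum A N θ‖ ^ 2 : ℝ) =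
      ∑ k ∈ Finset.range N, ∑ l ∈ Finset.range N,
        ⟪A k, A l⟫_ℂ * Complex.exp (((j + k - l : ℤ) : ℂ) * θ * Complex.I) := by
  have h : ((‖orbitSum A N θ‖ ^ 2 : ℝ) : ℂ) = ⟪orbitSum A N θ, orbitSum A N θ⟫_ℂ := by
    rw [inner_self_eq_norm_sq_to_K]
    simp
  rw [h, orbitSum, sum_inner, Finset.mul_sum]
  refine Finset.sum_congr rfl fun k _ => ?_
  rw [inner_sum, Finset.mul_sum]
  refine Finset.sum_congr rfl fun l _ => ?_
  rw [inner_smul_left, inner_smul_right, ← Complex.exp_conj]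
  have : Complex.exp (((j + k - l : ℤ) : ℂ) * θ * Complex.I) = Complex.exp (j * θ * Complex.I) *
      (Complex.exp (conj (-(k * θ * Complex.I))) * Complex.exp (-(l * θ * Complex.I))) := by
    rw [← Complex.exp_add, ← Complex.exp_add]
    congr 1
    simp only [map_neg, map_mul, Complex.conj_I, Complex.conj_ofReal, map_natCast]
    push_cast
    ring
  rw [this]
  ring

/-- Orthogonality of exponentials keeps only the pairs l = j + k with k, l < N. There are N - j of
them, whence the Fejér factor. -/
theorem integral_exp_mul_norm_orbitSum_sq (A : ℕ → H) {g : ℕ → ℂ}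
    (hA : ∀ k j, ⟪A k, A (j + k)⟫_ℂ = g j) {N j : ℕ} (hj : j ≤ N) :
    ∫ θ in (-Real.pi)..Real.pi, Complex.exp (j * θ * Complex.I) * (‖orbitSum A N θ‖ ^ 2 : ℝ) =
      2 * Real.pi * (N - j) * g j := by
  simp only [exp_mul_norm_orbitSum_sq]
  have hint : ∀ (c : ℂ) (n : ℤ), IntervalIntegrable
      (fun θ : ℝ => c * Complex.exp (n * θ * Complex.I)) volume (-Real.pi) Real.pi :=
    fun c n => (by fun_prop : Continuous fun θ : ℝ =>
      c * Complex.exp (n * θ * Complex.I)).intervalIntegrable _ _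
  rw [intervalIntegral.integral_finsetSum fun k _ =>
    Continuous.intervalIntegrable (by fun_prop) _ _]
  have h1 : ∀ k ∈ Finset.range N, ∫ θ in (-Real.pi)..Real.pi, ∑ l ∈ Finset.range N,
      ⟪A k, A l⟫_ℂ * Complex.exp (((j + k - l : ℤ) : ℂ) * θ * Complex.I) =
      if k < N - j then 2 * Real.pi * g j else 0 := by
    intro k hk
    rw [intervalIntegral.integral_finsetSum fun l _ => hint _ _]
    simp only [intervalIntegral.integral_const_mul, integral_exp_int_mul_I]
    have h2 : ∀ l ∈ Finset.range N, ⟪A k, A l⟫_ℂ *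
        (if (j + k - l : ℤ) = 0 then (2 * Real.pi : ℂ) else 0) =
        if j + k = l then 2 * Real.pi * g j else 0 := by
      intro l _
      by_cases h : j + k = l
      · rw [if_pos h, if_pos (by omega), ← h, hA]
        ring
      · rw [if_neg h, if_neg (by omega), mul_zero]
    rw [Finset.sum_congr rfl h2, Finset.sum_ite_eq]
    simp only [Finset.mem_range]
    refine if_congr ?_ rfl rfl
    omega
  rw [Finset.sum_congr rfl h1, ← Finset.sum_filter]
  have h3 : (Finset.range N).filter (fun k => k < N - j) = Finset.range (N - j) := by
    ext k
    simp only [Finset.mem_filter, Finset.mem_range]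
    omega
  rw [h3, Finset.sum_const, Finset.card_range, nsmul_eq_mul, Nat.cast_sub hj]
  ring

/-- A Fejér measure on `[-π, π]` whose Fourier coefficients approximate a stationary sequence. -/
theorem exists_fejer_measure (A : ℕ → H) {g : ℕ → ℂ}
    (hA : ∀ k j, ⟪A k, A (j + k)⟫_ℂ = g j) {N : ℕ} (hN : 0 < N) :
    ∃ ν : Measure ℝ, IsFiniteMeasure ν ∧ (∀ᵐ θ ∂ν, |θ| ≤ Real.pi) ∧
      ∀ j ≤ N, charFun ν j = (1 - j / N) * g j := by
  set p : ℝ → ℝ := fun θ => ‖orbitSum A N θ‖ ^ 2 / (2 * Real.pi * N) with hp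
  have hpc : Continuous p := ((continuous_orbitSum A N).norm.pow 2).div_const _
  have hp0 : ∀ θ, 0 ≤ p θ := fun θ => by positivity
  set μ₀ := (volume : Measure ℝ).restrict (Ioc (-Real.pi) Real.pi) with hμ₀
  have hle : -Real.pi ≤ Real.pi := by linarith [Real.pi_pos]
  have hpi : Integrable p μ₀ := (hpc.integrableOn_Icc).mono_set Ioc_subset_Icc_self
  refine ⟨μ₀.withDensity fun θ => ENNReal.ofReal (p θ),
    isFiniteMeasure_withDensity_ofReal hpi.2, ?_, fun j hj => ?_⟩
  · refine (withDensity_absolutelyContinuous _ _).ae_le ?_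
    filter_upwards [ae_restrict_mem measurableSet_Ioc] with θ hθ
    exact abs_le.2 ⟨hθ.1.le, hθ.2⟩
  · rw [charFun_apply_real, integral_withDensity_eq_integral_toReal_smul
      (hpc.measurable.ennreal_ofReal) (by simp)]
    simp only [ENNReal.toReal_ofReal (hp0 _)]
    have h1 := integral_exp_mul_norm_orbitSum_sq A hA hj
    rw [intervalIntegral.integral_of_le hle] at h1
    have hN0 : (N : ℂ) ≠ 0 := by exact_mod_cast hN.ne'
    have hpi0 : (Real.pi : ℂ) ≠ 0 := by exact_mod_cast Real.pi_ne_zero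
    have h2 : ∀ θ : ℝ, p θ • Complex.exp ((j : ℝ) * θ * Complex.I) = (2 * Real.pi * N : ℂ)⁻¹ *
        (Complex.exp (j * θ * Complex.I) * (‖orbitSum A N θ‖ ^ 2 : ℝ)) := fun θ => by
      rw [hp, Complex.real_smul]
      push_cast
      ring
    simp only [h2]
    rw [integral_const_mul, h1]
    field_simp

theorem norm_exp_mul_I_sub_one_sq (x : ℝ) :
    ‖Complex.exp (x * Complex.I) - 1‖ ^ 2 = 2 * (1 - Real.cos x) := by
  rw [← Complex.normSq_eq_norm_sq, Complex.normSq_apply, Complex.sub_re, Complex.sub_im,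
    Complex.exp_ofReal_mul_I_re, Complex.exp_ofReal_mul_I_im, Complex.one_re, Complex.one_im]
  nlinarith [Real.sin_sq_add_cos_sq x]

/-- For a measure carried by `[-π/h, π/h]`, the oscillation of the characteristic function at scale
`h` is controlled by its value at `h`. -/
theorem norm_charFun_sub_le {μ : Measure ℝ} [IsProbabilityMeasure μ] {h : ℝ}
    (hμ : ∀ᵐ x ∂μ, |h * x| ≤ Real.pi) {s t ε : ℝ} (hst : |t - s| ≤ |h|) (hε : 0 < ε) :
    ‖charFun μ t - charFun μ s‖ ≤ ε + 2 * (1 - (charFun μ h).re) / ε := by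
  have hint : ∀ t : ℝ, Integrable (fun x : ℝ => Complex.exp (t * x * Complex.I)) μ := fun t => by
    refine Integrable.of_bound (by fun_prop) 1 (Filter.Eventually.of_forall fun x => ?_)
    rw [← Complex.ofReal_mul, Complex.norm_exp_ofReal_mul_I]
  have hcos : (charFun μ h).re = ∫ x, Real.cos (h * x) ∂μ := by
    rw [charFun_apply_real]
    have := integral_re (hint h)
    simp only [RCLike.re_to_complex] at this
    rw [← this]
    refine integral_congr_ae (Filter.Eventually.of_forall fun x => ?_)
    simp only
    rw [← Complex.ofReal_mul, Complex.exp_ofReal_mul_I_re]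
  have hcosi : Integrable (fun x : ℝ => Real.cos (h * x)) μ :=
    Integrable.of_bound (by fun_prop) 1 (Filter.Eventually.of_forall fun x => by
      simpa using Real.abs_cos_le_one (h * x))
  have hpt : ∀ᵐ x : ℝ ∂μ, ‖Complex.exp (t * x * Complex.I) - Complex.exp (s * x * Complex.I)‖ ≤
      ε + 2 * (1 - Real.cos (h * x)) / ε := by
    filter_upwards [hμ] with x hx
    have h1 : Complex.exp (t * x * Complex.I) - Complex.exp (s * x * Complex.I) =
        Complex.exp ((s * x : ℝ) * Complex.I) *
          (Complex.exp (((t - s) * x : ℝ) * Complex.I) - 1) := by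
      rw [mul_sub, ← Complex.exp_add, mul_one]
      push_cast
      ring_nf
    rw [h1, norm_mul, Complex.norm_exp_ofReal_mul_I, one_mul]
    set z := ‖Complex.exp (((t - s) * x : ℝ) * Complex.I) - 1‖ with hz
    have h2 : z ^ 2 ≤ 2 * (1 - Real.cos (h * x)) := by
      rw [hz, norm_exp_mul_I_sub_one_sq]
      have h3 : |(t - s) * x| ≤ |h * x| := by
        rw [abs_mul, abs_mul]
        gcongr
      have h4 := Real.cos_le_cos_of_nonneg_of_le_pi (abs_nonneg _) hx h3
      rw [Real.cos_abs, Real.cos_abs] at h4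
      linarith
    have h5 : z ^ 2 / ε ≤ 2 * (1 - Real.cos (h * x)) / ε := by gcongr
    -- This stands in for Cauchy–Schwarz: the bound becomes linear in cos(hx), whose integral is the
    -- real part of the characteristic function at h.
    have h6 : z ≤ ε + z ^ 2 / ε := by
      rw [← sub_le_iff_le_add', le_div_iff₀ hε]
      nlinarith [sq_nonneg (z - ε), sq_nonneg (z + ε), sq_nonneg z]
    linarith
  rw [charFun_apply_real, charFun_apply_real, ← integral_sub (hint t) (hint s)]
  have hc1 : Integrable (fun x : ℝ => 1 - Real.cos (h * x)) μ := (integrable_const 1).sub hcosi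
  have hb : Integrable (fun x : ℝ => ε + 2 * (1 - Real.cos (h * x)) / ε) μ :=
    (integrable_const ε).add ((hc1.const_mul 2).div_const ε)
  refine (norm_integral_le_of_norm_le hb hpt).trans_eq ?_
  rw [integral_add (integrable_const ε)
    ((hc1.const_mul 2).div_const ε), integral_div,
    integral_const_mul, integral_sub (integrable_const (1 : ℝ)) hcosi, hcos]
  simp

/-- A pointwise limit of characteristic functions that is continuous at `0` is a characteristic
function. -/
theorem exists_probabilityMeasure_of_tendsto_charFun {μ : ℕ → ProbabilityMeasure ℝ} {f : ℝ → ℂ}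
    (hf : ContinuousAt f 0)
    (h : ∀ t, Filter.Tendsto (fun n => charFun (μ n : Measure ℝ) t) Filter.atTop (𝓝 (f t))) :
    ∃ ν : ProbabilityMeasure ℝ, ∀ t, charFun (ν : Measure ℝ) t = f t := by
  have htight := isTightMeasureSet_of_tendsto_charFun (μ := fun n => (μ n : Measure ℝ)) hf h
  have hcomp : IsCompact (closure (range μ)) :=
    isCompact_closure_of_isTightMeasureSet (by
      convert htight using 1
      ext x
      simp)
  -- A limit along one ultrafilter finer than `atTop` is enough, since f already prescribes its
  -- characteristic function.
  set U : Ultrafilter ℕ := Ultrafilter.of Filter.atTop with hU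
  obtain ⟨ν, -, hν⟩ := hcomp.ultrafilter_le_nhds (U.map μ) (by
    rw [Filter.le_principal_iff]
    exact Filter.mem_of_superset (Filter.mem_map.2 (Filter.univ_mem' fun n => mem_range_self n))
      subset_closure)
  refine ⟨ν, fun t => ?_⟩
  have hν' : Filter.Tendsto μ U (𝓝 ν) := hν
  rw [ProbabilityMeasure.tendsto_iff_forall_integral_rclike_tendsto ℂ] at hν'
  have h1 := hν' (BoundedContinuousFunction.innerProbChar t)
  simp only [← charFun_eq_integral_innerProbChar] at h1
  exact tendsto_nhds_unique h1 ((h t).mono_left (Ultrafilter.of_le _))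

/-- The orbit is sampled at step h = 1/(n+1) with N = h⁻² terms, and the Fejér measure is rescaled
by h⁻¹. At jh its transform is (1 - j/N)G(jh) with j/N = (jh)h, which tends to 0, while Nh → ∞ lets
the grid reach every t ≥ 0. Between grid points the oscillation is controlled by 1 minus the real
part of the transform at h, which tends to 0; negative t follow by conjugation. -/
theorem UnitaryGroup.exists_probabilityMeasure (V : UnitaryGroup H) {ξ : H} (hξ : ‖ξ‖ = 1) :
    ∃ ν : ProbabilityMeasure ℝ, ∀ t, charFun (ν : Measure ℝ) t = ⟪ξ, V.U t ξ⟫_ℂ := by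
  set G : ℝ → ℂ := fun t => ⟪ξ, V.U t ξ⟫_ℂ with hG
  have hGc : Continuous G := by
    have := V.continuous ξ
    fun_prop
  have hG0 : G 0 = 1 := by
    simp only [hG, V.map_zero]
    rw [inner_self_eq_norm_sq_to_K, hξ]
    simp
  have happ : ∀ n : ℕ, ∃ μ : ProbabilityMeasure ℝ,
      (∀ᵐ x ∂(μ : Measure ℝ), |(1 / ((n : ℝ) + 1)) * x| ≤ Real.pi) ∧
      ∀ j ≤ (n + 1) ^ 2, charFun (μ : Measure ℝ) (j * (1 / ((n : ℝ) + 1))) =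
        (1 - j / ((n : ℂ) + 1) ^ 2) * G (j * (1 / ((n : ℝ) + 1))) := by
    intro n
    set h : ℝ := 1 / ((n : ℝ) + 1) with hh
    have hh0 : 0 < h := by positivity
    obtain ⟨ν, hν, hsupp, hc⟩ := exists_fejer_measure (fun k : ℕ => V.U (k * h) ξ)
      (g := fun j => G (j * h)) (fun k j => by
        rw [V.inner_apply_left, ← V.map_add]
        congr 3
        push_cast
        ring) (N := (n + 1) ^ 2) (by positivity)
    have hch : ∀ t, charFun (ν.map (h⁻¹ * ·)) (t * h) = charFun ν t := fun t => by
      rw [charFun_map_mul]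
      congr 1
      field_simp
    have hprob : IsProbabilityMeasure (ν.map (h⁻¹ * ·)) := by
      have h1 := hc 0 (Nat.zero_le _)
      rw [← hch] at h1
      simp only [Nat.cast_zero, zero_mul, charFun_zero, zero_div, sub_zero, one_mul, hG0] at h1
      have h2 : (ν.map (h⁻¹ * ·)).real univ = 1 := by exact_mod_cast h1
      exact isProbabilityMeasure_iff_real.2 h2
    refine ⟨⟨ν.map (h⁻¹ * ·), hprob⟩, ?_, fun j hj => ?_⟩
    · refine (ae_map_iff (by fun_prop) (measurableSet_le (by fun_prop) (by fun_prop))).2 ?_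
      filter_upwards [hsupp] with θ hθ
      rwa [mul_inv_cancel_left₀ hh0.ne']
    · change charFun (ν.map (h⁻¹ * ·)) _ = _
      rw [hch, hc j hj]
      push_cast
      ring
  choose μ hsupp hμ using happ
  have hh : Filter.Tendsto (fun n : ℕ => 1 / ((n : ℝ) + 1)) Filter.atTop (𝓝 0) :=
    tendsto_one_div_add_atTop_nhds_zero_nat
  have hhC : Filter.Tendsto (fun n : ℕ => 1 / ((n : ℂ) + 1)) Filter.atTop (𝓝 0) := by
    have := (Complex.continuous_ofReal.tendsto 0).comp hh
    simpa [Function.comp_def] using this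
  refine exists_probabilityMeasure_of_tendsto_charFun (μ := μ) hGc.continuousAt ?_
  have hpos : ∀ t, 0 ≤ t →
      Filter.Tendsto (fun n => charFun (μ n : Measure ℝ) t) Filter.atTop (𝓝 (G t)) := by
    intro t ht
    set j : ℕ → ℕ := fun n => ⌊t * ((n : ℝ) + 1)⌋₊ with hj
    have hjle : ∀ n : ℕ, (j n : ℝ) * (1 / ((n : ℝ) + 1)) ≤ t := fun n => by
      have := Nat.floor_le (by positivity : 0 ≤ t * ((n : ℝ) + 1))
      rw [mul_one_div, div_le_iff₀ (by positivity)]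
      exact this
    have hjge : ∀ n : ℕ, t - 1 / ((n : ℝ) + 1) ≤ (j n : ℝ) * (1 / ((n : ℝ) + 1)) := fun n => by
      have := (Nat.lt_floor_add_one (t * ((n : ℝ) + 1))).le
      rw [sub_le_iff_le_add, ← add_one_mul, mul_one_div, le_div_iff₀ (by positivity)]
      exact this
    have hjt : Filter.Tendsto (fun n : ℕ => (j n : ℝ) * (1 / ((n : ℝ) + 1))) Filter.atTop (𝓝 t) :=
      tendsto_of_tendsto_of_tendsto_of_le_of_le (by simpa using hh.const_sub t)
        tendsto_const_nhds hjge hjle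
    have hjN : ∀ᶠ n : ℕ in Filter.atTop, j n ≤ (n + 1) ^ 2 := by
      filter_upwards [Filter.eventually_ge_atTop ⌈t⌉₊] with n hn
      have h1 : t ≤ n := (Nat.le_ceil t).trans (by exact_mod_cast hn)
      have h2 : (j n : ℝ) ≤ t * ((n : ℝ) + 1) := Nat.floor_le (by positivity)
      have h3 : (j n : ℝ) ≤ ((n : ℝ) + 1) ^ 2 := by nlinarith
      exact_mod_cast h3
    have hgrid : Filter.Tendsto (fun n : ℕ => charFun (μ n : Measure ℝ)
        ((j n : ℝ) * (1 / ((n : ℝ) + 1)))) Filter.atTop (𝓝 (G t)) := by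
      have h1 : Filter.Tendsto (fun n : ℕ => (1 - (j n : ℂ) / ((n : ℂ) + 1) ^ 2) *
          G ((j n : ℝ) * (1 / ((n : ℝ) + 1)))) Filter.atTop (𝓝 (G t)) := by
        have h2 := (hGc.tendsto t).comp hjt
        have h3 := ((Complex.continuous_ofReal.tendsto t).comp hjt).mul hhC
        have h4 := (h3.const_sub 1).mul h2
        simp only [mul_zero, sub_zero, one_mul] at h4
        refine h4.congr fun n => ?_
        have hn : (n : ℂ) + 1 ≠ 0 := Nat.cast_add_one_ne_zero n
        simp only [Function.comp]
        congr 1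
        push_cast
        field_simp
      refine h1.congr' ?_
      filter_upwards [hjN] with n hn
      exact (hμ n _ hn).symm
    have hone : Filter.Tendsto (fun n : ℕ => charFun (μ n : Measure ℝ) (1 / ((n : ℝ) + 1)))
        Filter.atTop (𝓝 1) := by
      have h2 := (hGc.tendsto 0).comp hh
      have h4 := ((hhC.pow 2).const_sub 1).mul h2
      simp only [hG0, ne_eq, OfNat.ofNat_ne_zero, not_false_eq_true, zero_pow, sub_zero,
        one_mul] at h4
      refine h4.congr fun n => ?_
      have := hμ n 1 (Nat.one_le_pow _ _ (by omega))
      simp only [Nat.cast_one, one_mul] at this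
      rw [this]
      simp
    have hre := (Complex.continuous_re.tendsto _).comp hone
    have hdiff : Filter.Tendsto (fun n : ℕ => charFun (μ n : Measure ℝ) t -
        charFun (μ n : Measure ℝ) ((j n : ℝ) * (1 / ((n : ℝ) + 1)))) Filter.atTop (𝓝 0) := by
      rw [Metric.tendsto_nhds]
      intro ε hε
      have h1 : Filter.Tendsto (fun n : ℕ => ε / 2 + 2 * (1 - (charFun (μ n : Measure ℝ)
          (1 / ((n : ℝ) + 1))).re) / (ε / 2)) Filter.atTop (𝓝 (ε / 2)) := by
        have := ((((hre.const_sub 1).const_mul 2).div_const (ε / 2)).const_add (ε / 2))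
        simpa using this
      filter_upwards [h1.eventually_lt_const (by linarith : ε / 2 < ε)] with n hn
      rw [dist_zero_right]
      refine (norm_charFun_sub_le (hsupp n) ?_ (by positivity)).trans_lt hn
      have h2 : (0 : ℝ) < 1 / ((n : ℝ) + 1) := by positivity
      rw [abs_of_pos h2, abs_le]
      constructor <;> linarith [hjle n, hjge n]
    simpa using hdiff.add hgrid
  intro t
  rcases le_total 0 t with ht | ht
  · exact hpos t ht
  · have h1 := (Complex.continuous_conj.tendsto _).comp (hpos (-t) (by linarith))
    have h2 : conj (G (-t)) = G t := by
      simp only [hG]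
      rw [inner_conj_symm, V.inner_apply_left, neg_neg]
    rw [h2] at h1
    refine h1.congr fun n => ?_
    simp only [Function.comp]
    rw [← charFun_neg, neg_neg]

/-- Every diagonal matrix coefficient of a unitary group is the transform of a finite measure. -/
theorem UnitaryGroup.exists_measure (V : UnitaryGroup H) (ξ : H) :
    ∃ μ : Measure ℝ, IsFiniteMeasure μ ∧ ∀ t, charFun μ t = ⟪ξ, V.U t ξ⟫_ℂ := by
  rcases eq_or_ne ξ 0 with rfl | hξ
  · exact ⟨0, inferInstance, fun t => by simp⟩
  obtain ⟨ν, hν⟩ := V.exists_probabilityMeasure (ξ := (‖ξ‖⁻¹ : ℂ) • ξ) (by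
    rw [norm_smul]
    simp [hξ])
  refine ⟨(‖ξ‖₊ ^ 2) • (ν : Measure ℝ), inferInstance, fun t => ?_⟩
  have h1 := hν t
  have h0 : (‖ξ‖ : ℂ) ≠ 0 := by exact_mod_cast norm_ne_zero_iff.2 hξ
  rw [map_smul, inner_smul_left, inner_smul_right] at h1
  rw [charFun_apply, integral_smul_nnreal_measure, ← charFun_apply, h1, NNReal.smul_def,
    Complex.real_smul]
  push_cast
  simp only [map_inv₀, Complex.conj_ofReal]
  field_simp

end

/-! ### The translation group of an analytic positive definite function -/

namespace LocalPD

variable {a : ℝ} (F : LocalPD a)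

open scoped Classical in
/-- The kernel functions, extended by `0` outside `Ω`. -/
noncomputable def kerFnExt (y : ℝ) : F.HF := if h : y ∈ Ioo 0 a then F.kerFn ⟨y, h⟩ else 0

theorem kerFnExt_of_mem {y : ℝ} (h : y ∈ Ioo 0 a) : F.kerFnExt y = F.kerFn ⟨y, h⟩ := dif_pos h

theorem inner_kerFnExt : ∀ x ∈ Ioo 0 a, ∀ y ∈ Ioo 0 a,
    ⟪F.kerFnExt x, F.kerFnExt y⟫_ℂ = F.toFun (x - y) := fun x hx y hy => by
  rw [kerFnExt_of_mem F hx, kerFnExt_of_mem F hy, inner_kerFn, kerFn_apply]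

theorem continuousOn_kerFnExt : ContinuousOn F.kerFnExt (Ioo 0 a) := by
  rw [continuousOn_iff_continuous_domRestrict]
  refine F.continuous_kerFn.congr fun y => ?_
  rw [Set.domRestrict_apply, kerFnExt_of_mem F y.2]

theorem eq_zero_of_inner_kerFn {ξ : F.HF} (h : ∀ y, ⟪ξ, F.kerFn y⟫_ℂ = 0) : ξ = 0 := by
  refine RKHS.ext fun x => ?_
  rw [← inner_kerFn, ← inner_conj_symm, h, RKHS.coe_zero]
  simp

variable {F}

theorem eq_zero_of_inner_kerFn_of_isOpen (hF : AnalyticAt ℝ F.toFun 0) {ξ : F.HF} {U : Set ℝ}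
    (hU : IsOpen U) (hne : (Ioo 0 a ∩ U).Nonempty)
    (h : ∀ y : Ioo (0 : ℝ) a, (y : ℝ) ∈ U → ⟪ξ, F.kerFn y⟫_ℂ = 0) : ξ = 0 := by
  refine F.eq_zero_of_inner_kerFn fun y => ?_
  rw [← F.kerFnExt_of_mem y.2]
  refine inner_eq_zero_of_analyticAt hF F.inner_kerFnExt hU hne (fun y hy => ?_) y y.2
  rw [F.kerFnExt_of_mem hy.1]
  exact h ⟨y, hy.1⟩ hy.2

/-- A unitary group on `H_F` with a continuous orbit extending the kernel functions. -/
structure TranslationGroup (F : LocalPD a) where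
  group : UnitaryGroup F.HF
  vec : ℝ → F.HF
  continuous_vec : Continuous vec
  vec_coe : ∀ y : Ioo (0 : ℝ) a, vec y = F.kerFn y
  map_vec : ∀ t y, group.U t (vec y) = vec (y - t)

theorem nonempty_translationGroup (ha : 0 < a) (hF : AnalyticAt ℝ F.toFun 0) :
    Nonempty (TranslationGroup F) := by
  obtain ⟨V, hV⟩ := exists_unitaryGroup ha hF F.inner_kerFnExt F.continuousOn_kerFnExt
    fun ξ hξ => F.eq_zero_of_inner_kerFn fun y => by
      rw [← F.kerFnExt_of_mem y.2]
      exact hξ y y.2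
  have hmid : a / 2 ∈ Ioo 0 a := ⟨by linarith, by linarith⟩
  -- The orbit through F_{a/2} continues y ↦ F_y to all of ℝ. It supplies in particular the boundary
  -- vector `vec 0`, which is F_0.
  refine ⟨⟨V, fun y => V.U (a / 2 - y) (F.kerFnExt (a / 2)), ?_, fun y => ?_, fun t y => ?_⟩⟩
  · exact (V.continuous _).comp (by fun_prop)
  · rw [hV _ _ hmid (by rw [sub_sub_cancel]; exact y.2), sub_sub_cancel, F.kerFnExt_of_mem y.2]
  · rw [← V.map_add]
    congr 2
    ring

namespace TranslationGroup

variable (T : TranslationGroup F)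

theorem inner_vec_sub (y z x : ℝ) : ⟪T.vec y, T.vec (y - x)⟫_ℂ = ⟪T.vec z, T.vec (z - x)⟫_ℂ := by
  have h1 : T.vec y = T.group.U (z - y) (T.vec z) := by rw [T.map_vec, sub_sub_cancel]
  have h2 : T.vec (y - x) = T.group.U (z - y) (T.vec (z - x)) := by
    rw [T.map_vec]
    congr 1
    ring
  rw [h1, h2, LinearIsometryEquiv.inner_map_map]

theorem inner_vec_eq {x : ℝ} (hx : x ∈ Ioo (-a) a) (z : ℝ) :
    ⟪T.vec z, T.vec (z - x)⟫_ℂ = F.toFun x := by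
  have h1 : (a + x) / 2 ∈ Ioo 0 a := ⟨by linarith [hx.1], by linarith [hx.2]⟩
  have h2 : (a + x) / 2 - x ∈ Ioo 0 a := ⟨by linarith [hx.2], by linarith [hx.1]⟩
  rw [T.inner_vec_sub z ((a + x) / 2)]
  rw [T.vec_coe ⟨_, h1⟩, T.vec_coe ⟨_, h2⟩, inner_kerFn, kerFn_apply, sub_sub_cancel]

/-! ### Smeared vectors, the generator and the operator `D` -/

theorem integrable_smul_vec {ψ : ℝ → ℂ} (hψ : Continuous ψ) (hc : HasCompactSupport ψ)
    {g : ℝ → F.HF} (hg : Continuous g) : Integrable fun y => ψ y • g y :=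
  (hψ.smul hg).integrable_of_hasCompactSupport hc.smul_right

theorem smear_eq (ψ : testFn a) : F.smear ψ = ∫ y, ψ.1 y • T.vec y := by
  have h1 : F.smear ψ =
      ∫ y : Ioo (0 : ℝ) a, (fun y : ℝ => ψ.1 y • T.vec y) y ∂(volume.comap Subtype.val) :=
    integral_congr_ae (Filter.Eventually.of_forall fun y => by simp only [T.vec_coe])
  rw [h1, integral_subtype_comap measurableSet_Ioo (fun y : ℝ => ψ.1 y • T.vec y)]
  refine setIntegral_eq_integral_of_forall_compl_eq_zero fun y hy => ?_
  rw [image_eq_zero_of_notMem_tsupport fun h => hy (ψ.2.2.2 h), zero_smul]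

theorem map_smear (ψ : testFn a) (t : ℝ) :
    T.group.U t (F.smear ψ) = ∫ y, ψ.1 y • T.vec (y - t) := by
  rw [T.smear_eq]
  have h := (T.group.U t).toLinearIsometry.toContinuousLinearMap.integral_comp_comm
    (integrable_smul_vec ψ.2.1.continuous ψ.2.2.1 T.continuous_vec)
  refine Eq.trans h.symm (integral_congr_ae (Filter.Eventually.of_forall fun y => ?_))
  simp [T.map_vec]

/-- U(t)F_ψ is the convolution of ψ with u ↦ vec(-u), evaluated at t. The derivative falls on ψ, so
`vec` need only be continuous. -/
theorem hasDerivAt_map_smear (ψ : testFn a) :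
    HasDerivAt (fun t : ℝ => T.group.U t (F.smear ψ)) (F.smear (testFn.deriv a ψ)) 0 := by
  have hg : LocallyIntegrable (fun u => T.vec (-u)) :=
    (T.continuous_vec.comp continuous_neg).locallyIntegrable
  have h := ψ.2.2.1.hasDerivAt_convolution_left (ContinuousLinearMap.lsmul ℝ ℂ)
    (ψ.2.1.of_le (by simp)) hg 0
  have h1 : (fun t : ℝ => T.group.U t (F.smear ψ)) =
      convolution ψ.1 (fun u => T.vec (-u)) (ContinuousLinearMap.lsmul ℝ ℂ) volume := by
    ext1 t
    rw [T.map_smear, convolution]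
    simp
  have h2 : F.smear (testFn.deriv a ψ) = convolution (deriv ψ.1) (fun u => T.vec (-u))
      (ContinuousLinearMap.lsmul ℝ ℂ) volume 0 := by
    rw [T.smear_eq, convolution]
    simp [testFn.deriv]
  rw [h1, h2]
  exact h

theorem smear_mem_domain (ψ : testFn a) : F.smear ψ ∈ F.D.domain :=
  LinearPMap.mem_domain_of_mem_graph (y := F.smear (testFn.deriv a ψ))
    (by rw [F.graph_D]; exact ⟨ψ, rfl⟩)

theorem generatorExtends : T.group.GeneratorExtends F.D := by
  intro ξ
  have h := F.D.mem_graph ξ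
  rw [F.graph_D] at h
  obtain ⟨ψ, hψ⟩ := h
  have h1 : F.smear ψ = ξ := congrArg Prod.fst hψ
  have h2 : F.smear (testFn.deriv a ψ) = F.D ξ := congrArg Prod.snd hψ
  rw [← h1, ← h2]
  exact T.hasDerivAt_map_smear ψ

/-- U(t) merely replaces ψ by ψ(· + t), again a test function on Ω while its support stays inside.
-/
theorem map_smear_mem_domain {ψ : testFn a} {t : ℝ} (hψ : ∀ y ∈ tsupport ψ.1, y - t ∈ Ioo 0 a) :
    T.group.U t (F.smear ψ) ∈ F.D.domain := by
  have hts : tsupport (fun y => ψ.1 (y + t)) = (Homeomorph.addRight t) ⁻¹' tsupport ψ.1 :=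
    tsupport_comp_eq_preimage ψ.1 (Homeomorph.addRight t)
  set φ : testFn a := ⟨fun y => ψ.1 (y + t), ψ.2.1.comp (contDiff_id.add contDiff_const),
    ψ.2.2.1.comp_homeomorph (Homeomorph.addRight t), fun y hy => by
      rw [hts] at hy
      simpa using hψ (y + t) hy⟩ with hφ
  have h : T.group.U t (F.smear ψ) = F.smear φ := by
    rw [T.map_smear, T.smear_eq, ← integral_add_right_eq_self _ t]
    simp [hφ]
  rw [h]
  exact smear_mem_domain φ

/-- Real test functions already force the continuous function y ↦ ⟨ξ, vec y⟩ to vanish on U;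
uniqueness of continuation does the rest. -/
theorem eq_zero_of_inner_smear (T : TranslationGroup F) (hF : AnalyticAt ℝ F.toFun 0)
    {U : Set ℝ} (hU : IsOpen U) (hUa : U ⊆ Ioo 0 a) (hne : U.Nonempty) {ξ : F.HF}
    (h : ∀ ψ : testFn a, tsupport ψ.1 ⊆ U → ⟪ξ, F.smear ψ⟫_ℂ = 0) : ξ = 0 := by
  have hcont : Continuous fun y => ⟪ξ, T.vec y⟫_ℂ := continuous_const.inner T.continuous_vec
  have hae := hU.ae_eq_zero_of_integral_contDiff_smul_eq_zero (μ := (volume : Measure ℝ))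
    (hcont.locallyIntegrable.locallyIntegrableOn U) fun g hg hgc hgU => by
      have hsub : tsupport (fun y => (g y : ℂ)) ⊆ tsupport g :=
        closure_mono fun y hy => by simpa using hy
      set ψ : testFn a := ⟨fun y => (g y : ℂ), Complex.ofRealCLM.contDiff.comp hg,
        hgc.comp_left (g := Complex.ofReal) Complex.ofReal_zero,
        hsub.trans (hgU.trans hUa)⟩ with hψ
      have h1 := h ψ (hsub.trans hgU)
      rw [T.smear_eq, ← integral_inner
        (integrable_smul_vec ψ.2.1.continuous ψ.2.2.1 T.continuous_vec)] at h1
      rw [← h1]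
      refine integral_congr_ae (Filter.Eventually.of_forall fun y => ?_)
      simp [hψ]
  have hzero : EqOn (fun y => ⟪ξ, T.vec y⟫_ℂ) (fun _ => 0) U :=
    Measure.eqOn_open_of_ae_eq ((ae_restrict_iff' hU.measurableSet).2 hae) hU
      hcont.continuousOn continuousOn_const
  refine eq_zero_of_inner_kerFn_of_isOpen hF hU
    (by rwa [inter_eq_self_of_subset_right hUa]) fun y hy => ?_
  rw [← T.vec_coe]
  exact hzero hy

theorem isEssentiallySkewAdjoint (T : TranslationGroup F) (ha : 0 < a) (hF : AnalyticAt ℝ F.toFun 0) :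
    IsEssentiallySkewAdjoint F.D ∧ deficiencyIndices F.D = (0, 0) := by
  set J : Set ℝ := Ioo (a / 3) (2 * a / 3) with hJ
  refine T.group.isEssentiallySkewAdjoint T.generatorExtends (δ := a / 3) (by positivity)
    (S := {ξ | ∃ ψ : testFn a, tsupport ψ.1 ⊆ J ∧ F.smear ψ = ξ}) ?_ fun ξ hξ => ?_
  · rintro _ ⟨ψ, hψ, rfl⟩ t ht
    refine T.map_smear_mem_domain fun y hy => ?_
    obtain ⟨h1, h2⟩ := hψ hy
    obtain ⟨h3, h4⟩ := abs_lt.1 ht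
    constructor <;> linarith
  · refine T.eq_zero_of_inner_smear hF isOpen_Ioo (U := J) (Ioo_subset_Ioo ?_ ?_)
      ⟨a / 2, ?_, ?_⟩ fun ψ hψ => hξ _ ⟨ψ, hψ, rfl⟩ <;> linarith

/-! ### Uniqueness and type of the extension -/

/-- The transform of any extension is the matrix coefficient of the translation group. -/
theorem charFun_eq (ha : 0 < a) (hF : AnalyticAt ℝ F.toFun 0) {μ : Measure ℝ} (hμ : μ ∈ F.Ext)
    (t : ℝ) : charFun μ t = ⟪T.vec 0, T.group.U t (T.vec 0)⟫_ℂ := by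
  obtain ⟨hfin, hext⟩ := hμ
  have hmem : ∀ y : ℝ, MemLp (fun x : ℝ => Complex.exp (-(y * x * Complex.I))) 2 μ := fun y =>
    MemLp.of_bound (by fun_prop) 1 (Filter.Eventually.of_forall fun x => by
      rw [← Complex.ofReal_mul, ← neg_mul, ← Complex.ofReal_neg, Complex.norm_exp_ofReal_mul_I])
  set e : ℝ → Lp ℂ 2 μ := fun y => (hmem y).toLp _ with he
  have hinner : ∀ x y, ⟪e x, e y⟫_ℂ = charFun μ (x - y) := fun x y => by
    rw [L2.inner_def, charFun_apply_real]
    refine integral_congr_ae ?_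
    filter_upwards [(hmem x).coeFn_toLp, (hmem y).coeFn_toLp] with z hx hy
    rw [he, hx, hy, RCLike.inner_apply, ← Complex.exp_conj, ← Complex.exp_add]
    congr 1
    simp only [map_neg, map_mul, Complex.conj_I, Complex.conj_ofReal]
    push_cast
    ring
  have hdense : Dense (Submodule.span ℂ (range F.kerFn) : Set F.HF) :=
    dense_span_of_forall_inner_eq_zero fun ξ hξ =>
      F.eq_zero_of_inner_kerFn fun y => hξ _ ⟨y, rfl⟩
  -- Each window Ω + s of exponentials in L²(μ) has the Gram kernel of H_F, since only differences
  -- in (-a, a) enter.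
  have hiso : ∀ s : ℝ, ∃ W : F.HF →ₗᵢ[ℂ] Lp ℂ 2 μ, ∀ y, W (F.kerFn y) = e (y + s) := fun s =>
    exists_linearIsometry_of_inner_eq hdense fun x y => by
      rw [inner_kerFn, kerFn_apply, hinner, add_sub_add_right_eq_sub, hext]
      exact ⟨by linarith [x.2.1, y.2.2], by linarith [x.2.2, y.2.1]⟩
  choose W hW using hiso
  -- Both sides agree on F_y when y and y - t lie in Ω, a family that is total by uniqueness of
  -- continuation. Steps of size t/n then reach arbitrary t.
  have hlocal : ∀ s t, |t| < a → ∀ ξ, W s (T.group.U t ξ) = W (s - t) ξ := by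
    intro s t ht ξ
    obtain ⟨h1, h2⟩ := abs_lt.1 ht
    set U : Set ℝ := {y | y - t ∈ Ioo 0 a} with hU
    have hUo : IsOpen U := isOpen_Ioo.preimage (by fun_prop)
    have hne : (Ioo 0 a ∩ U).Nonempty := by
      refine ⟨(a + t) / 2, ⟨?_, ?_⟩, ?_, ?_⟩ <;> linarith
    have hd : Dense (Submodule.span ℂ (F.kerFn '' {y | (y : ℝ) ∈ U}) : Set F.HF) :=
      dense_span_of_forall_inner_eq_zero fun ξ hξ =>
        eq_zero_of_inner_kerFn_of_isOpen hF hUo hne fun y hy => hξ _ ⟨y, hy, rfl⟩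
    have := ContinuousLinearMap.ext_on hd
      (f := (W s).toContinuousLinearMap ∘L (T.group.U t).toLinearIsometry.toContinuousLinearMap)
      (g := (W (s - t)).toContinuousLinearMap) (by
        rintro _ ⟨y, hy, rfl⟩
        change W s (T.group.U t (F.kerFn y)) = W (s - t) (F.kerFn y)
        rw [← T.vec_coe y, T.map_vec, T.vec_coe ⟨_, hy⟩, hW, T.vec_coe, hW]
        congr 1
        simp only
        ring)
    exact congrArg (fun A : F.HF →L[ℂ] Lp ℂ 2 μ => A ξ) this
  have hglobal : ∀ t, ∀ ξ, W 0 (T.group.U t ξ) = W (-t) ξ := by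
    intro t ξ
    obtain ⟨n, hn⟩ := exists_nat_gt (|t| / a)
    have hn0 : (0 : ℝ) < n := lt_of_le_of_lt (by positivity) hn
    have hsmall : |t / n| < a := by
      rw [abs_div, Nat.abs_cast, div_lt_iff₀ hn0]
      rw [div_lt_iff₀ ha] at hn
      linarith
    have hk : ∀ (k : ℕ) ξ, W 0 (T.group.U (k * (t / n)) ξ) = W (-(k * (t / n))) ξ := by
      intro k
      induction k with
      | zero => intro ξ; simp [T.group.map_zero]
      | succ k ih =>
        intro ξ
        push_cast
        rw [add_one_mul, T.group.map_add, ih, hlocal _ _ hsmall, neg_add, sub_eq_add_neg]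
    have := hk n ξ
    rwa [mul_div_cancel₀ _ hn0.ne'] at this
  have hmid : a / 2 ∈ Ioo 0 a := ⟨by linarith, by linarith⟩
  have h1 : W 0 (F.kerFn ⟨_, hmid⟩) = e (a / 2) := by rw [hW, add_zero]
  have h2 : W (-t) (F.kerFn ⟨_, hmid⟩) = e (a / 2 - t) := by rw [hW, sub_eq_add_neg]
  rw [T.map_vec, T.inner_vec_sub 0 (a / 2), ← T.map_vec, ← (W 0).inner_map_map, hglobal,
    T.vec_coe ⟨_, hmid⟩, h1, h2, hinner, sub_sub_cancel]

theorem exists_unique_extension (T : TranslationGroup F) (ha : 0 < a) (hF : AnalyticAt ℝ F.toFun 0) :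
    ∃ μ : Measure ℝ, F.Ext = {μ} ∧ F.Ext₁ = {μ} := by
  obtain ⟨μ, hfin, hμ⟩ := T.group.exists_measure (T.vec 0)
  have hmem : μ ∈ F.Ext := ⟨hfin, fun x hx => by rw [hμ, T.map_vec, T.inner_vec_eq hx]⟩
  have huniq : ∀ ν ∈ F.Ext, ν = μ := fun ν hν => by
    have := hν.1
    refine Measure.ext_of_charFun ?_
    ext t
    rw [T.charFun_eq ha hF hν, hμ]
  refine ⟨μ, Set.eq_singleton_iff_unique_mem.2 ⟨hmem, huniq⟩,
    Set.eq_singleton_iff_unique_mem.2 ⟨⟨hmem, T.group, T.vec 0, fun x => ?_, T.generatorExtends,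
      hμ⟩, fun ν hν => huniq ν hν.1⟩⟩
  rw [← inner_kerFn, ← T.vec_coe]
  have := T.inner_vec_eq (x := x) ⟨by linarith [x.2.1], x.2.2⟩ x
  rwa [sub_self] at this

end TranslationGroup

end LocalPD

theorem mainTheorem2 (a : ℝ) (ha : 0 < a) (F : LocalPD a) (hF : AnalyticAt ℝ F.toFun 0) :
    IsEssentiallySkewAdjoint F.D ∧ deficiencyIndices F.D = (0, 0) ∧
      ∃ μ : Measure ℝ, F.Ext = {μ} ∧ F.Ext₁ = {μ} ∧ F.Ext₂ = ∅ := by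
  obtain ⟨T⟩ := LocalPD.nonempty_translationGroup ha hF
  obtain ⟨h1, h2⟩ := T.isEssentiallySkewAdjoint ha hF
  obtain ⟨μ, h3, h4⟩ := T.exists_unique_extension ha hF
  exact ⟨h1, h2, μ, h3, h4, by rw [LocalPD.Ext₂, h3, h4, sdiff_self]⟩
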